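/- Let $F$ be a finite field with $q$ elements, let $\mathbb{R}_F=F((1/t))$ with the absolute value $|x|=q^{-v(x)}$, where $v$ is the valuation with uniformizer $1/t$, and extend $|\cdot|$ to an algebraic closure $\overline{\mathbb{R}_F}$. Let $\mathbb{T}_F=\mathbb{R}_F/F[t]$ with the quotient topology. An element $\alpha\in\overline{\mathbb{R}_F}$ with $|\alpha|=1$ satisfies $|\alpha-\alpha_{(0)}|<1$ for a unique root of unity $\alpha_{(0)}$; the multiplicative order of $\alpha_{(0)}$ is called the order of $\alpha$ modulo $\mathfrak p$. Let $d\ge 1$ and $A\in M_d(F[t])$, and denote also by $A$ the endomorphism of $\mathbb{T}_F^d$ given by multiplication by $A$. For $k\ge 1$ let $N_k(A)$ be the number of isolated fixed points of $A^k$ on $\mathbb{T}_F^d$ (the isolated points of its set of fixed points), and let $$\zeta_A(z)=\exp\Big(\sum_{k\ge 1}\frac{N_k(A)}{k}z^k\Big)\in\mathbb{C}[[z]].$$ Put $r(A)=\prod_\lambda\max\{1,|\lambda|\}$, where $\lambda$ ranges over the $d$ eigenvalues of $A$ in $\overline{\mathbb{R}_F}$, counted with multiplicity. Let $\mu_1,\dots,\mu_M$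 be the eigenvalues (with multiplicity) that are roots of unity, and $\eta_1,\dots,\eta_N$ those (with multiplicity) that have absolute value $1$ and are not roots of unity; $M=0$ and $N=0$ are allowed. Let $m_i$ be the order of $\mu_i$ and $n_j$ the order of $\eta_j$ modulo $\mathfrak p$. **Theorem 1.4.** For every $k\ge 1$, $N_k(A)$ is finite and $N_k(A)=|\det(A^k-I)|$. Moreover: (a) Suppose that for every $j\in\{1,\dots,N\}$ there is $i\in\{1,\dots,M\}$ with $m_i\mid n_j$. Then $\zeta_A(z)$ is algebraic over $\mathbb{C}(z)$, and $$\zeta_A(z)=(1-r(A)z)^{-1}\prod_{\ell=1}^{M}\ \prod_{1\le i_1<\dots<i_\ell\le M}\Big(1-(r(A)z)^{\operatorname{lcm}(m_{i_1},\dots,m_{i_\ell})}\Big)^{(-1)^{\ell+1}/\operatorname{lcm}(m_{i_1},\dots,m_{i_\ell})}$$ in $\mathbb{C}[[z]]$, where for $L\ge 1$ and $a\in\mathbb{Q}$ the power $(1-(rz)^L)^a$ is the binomial series $\sum_{n\ge 0}\binom{a}{n}(-1)^n(rz)^{Ln}$. (b) Otherwise, that is, if there is $j\in\{1,\dots,N\}$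 such that $m_i\nmid n_j$ for every $i\in\{1,\dots,M\}$, the series $\sum_{k\ge 1}N_k(A)z^k$ converges for every $z\in\mathbb{C}$ with $|z|<1/r(A)$, and it is not D-finite (its formal derivatives of all orders $\ge 0$ do not span a finite-dimensional $\mathbb{C}(z)$-subspace of $\mathbb{C}((z))$). Moreover $\zeta_A(z)$ is transcendental over $\mathbb{C}(z)$. -/

import Mathlib

open scoped NNReal Polynomial LaurentSeries RatFunc

noncomputable section

/-! ### The local field `F((1/t))` -/

/-- The field `F((1/t))`: Laurent series over `F` in the variable `1/t`. -/
abbrev RF (F : Type*) [Field F] : Type _ := F⸨X⸩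

/-- The embedding `F[t] → F((1/t))`.  Since the variable of the Laurent series is `1/t`, it sends
`t` to the series with the single coefficient `1` in degree `-1`. -/
def polyToRF (F : Type*) [Field F] : F[X] →+* RF F :=
  Polynomial.eval₂RingHom (HahnSeries.C : F →+* RF F) (HahnSeries.single (-1 : ℤ) (1 : F))

theorem one_lt_card_field (F : Type*) [Field F] [Finite F] : (1 : ℝ≥0) < (Nat.card F : ℝ≥0) := by
  exact_mod_cast Finite.one_lt_card (α := F)

/-- The valuation on `F((1/t))` for which `1/t` is a uniformizer has rank one; its value group is
embedded in the positive reals so that `|1/t| = 1/q`, with `q` the number of elements of `F`. -/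
instance rankOneRF (F : Type*) [Field F] [Finite F] :
    Valuation.RankOne (Valued.v : Valuation (RF F) (WithZero (Multiplicative ℤ))) where
  hom' := (WithZeroMulInt.toNNReal (one_lt_card_field F).ne_zero).comp
    (MonoidWithZeroHom.ValueGroup₀.embedding)
  strictMono' := (WithZeroMulInt.toNNReal_strictMono (one_lt_card_field F)).comp
    MonoidWithZeroHom.ValueGroup₀.embedding_strictMono
  exists_val_nontrivial := by
    refine ⟨HahnSeries.single (1 : ℤ) (1 : F), ?_, ?_⟩
    · rw [LaurentSeries.valuation_single_zpow]; simp
    · rw [LaurentSeries.valuation_single_zpow]; decide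

/-- `F((1/t))` with its absolute value `|x| = q ^ (-v(x))`; its topology is the valuation
topology. -/
instance normedFieldRF (F : Type*) [Field F] [Finite F] : NormedField (RF F) :=
  Valued.toNormedField (RF F) (WithZero (Multiplicative ℤ))

/-- The absolute value is `q ^ m` where `m` is the largest exponent of `t` in the series, that is
`q ^ (-v(x))` with `v(x)` the order of the series in `1/t`. -/
theorem norm_RF {F : Type*} [Field F] [Finite F] {x : RF F} (hx : x ≠ 0) :
    ‖x‖ = (Nat.card F : ℝ) ^ (-x.order) := by
  have hv : (Valued.v x : WithZero (Multiplicative ℤ)) = WithZero.exp (-x.order) := by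
    apply le_antisymm
    · rw [LaurentSeries.valuation_le_iff_coeff_lt_eq_zero]
      exact fun n hn => HahnSeries.coeff_eq_zero_of_lt_order hn
    · by_contra! h
      have h2 : (Valued.v x : WithZero (Multiplicative ℤ)) ≤ WithZero.exp (-(x.order + 1)) := by
        have h0 : (Valued.v x : WithZero (Multiplicative ℤ)) ≠ 0 := by simpa using hx
        rw [← WithZero.exp_log h0, WithZero.exp_lt_exp] at h
        rw [← WithZero.exp_log h0, WithZero.exp_le_exp]
        omega
      rw [LaurentSeries.valuation_le_iff_coeff_lt_eq_zero] at h2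
      exact hx (HahnSeries.coeff_order_eq_zero.mp (h2 _ (by omega)))
  have h1 : ‖x‖ = (WithZeroMulInt.toNNReal (one_lt_card_field F).ne_zero
      (Valued.v x : WithZero (Multiplicative ℤ)) : ℝ) := by
    change Valuation.norm _ x = _
    rw [Valuation.norm_def]
    change ((WithZeroMulInt.toNNReal (one_lt_card_field F).ne_zero
      (MonoidWithZeroHom.ValueGroup₀.embedding _) : ℝ≥0) : ℝ) = _
    rw [Valuation.embedding_restrict]
  rw [h1, hv, WithZeroMulInt.toNNReal_neg_apply _ WithZero.exp_ne_zero]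
  change (((Nat.card F : ℝ≥0) ^ (-x.order) : ℝ≥0) : ℝ) = _
  push_cast
  rfl

/-- The algebraic closure of `F((1/t))`. -/
abbrev RFbar (F : Type*) [Field F] : Type _ := AlgebraicClosure (RF F)

/-- The unique extension of the absolute value of `F((1/t))` to its algebraic closure. -/
def absBar {F : Type*} [Field F] [Finite F] (x : RFbar F) : ℝ := spectralNorm (RF F) (RFbar F) x

/-! ### Constant terms and orders modulo the maximal ideal -/

/-- `a` is the constant term (Teichmüller representative) of `x`: it is `0` or a root of unity, and
`x - a` lies in the maximal ideal. -/
def IsConstantTerm {F : Type*} [Field F] [Finite F] (x a : RFbar F) : Prop :=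
  (a = 0 ∨ IsOfFinOrder a) ∧ absBar (x - a) < 1

/-- The constant term of an element of absolute value at most one. -/
def constantTerm {F : Type*} [Field F] [Finite F] (x : RFbar F) : RFbar F :=
  Classical.epsilon fun a => IsConstantTerm x a

/-- The order of `x` modulo the maximal ideal (for `|x| = 1`): the multiplicative order of its
constant term. -/
def orderMod {F : Type*} [Field F] [Finite F] (x : RFbar F) : ℕ := orderOf (constantTerm x)

/-! ### The torus and its endomorphisms -/

/-- The torus `F((1/t)) / F[t]`, with the quotient topology. -/
abbrev TF (F : Type*) [Field F] : Type _ := RF F ⧸ (polyToRF F).toAddMonoidHom.range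

/-- Multiplication by a polynomial on the torus. -/
def polyMulTF {F : Type*} [Field F] (b : F[X]) : TF F →+ TF F :=
  QuotientAddGroup.map _ _ (AddMonoidHom.mulLeft (polyToRF F b)) (by
    rintro _ ⟨c, rfl⟩
    exact ⟨b * c, by simp⟩)

/-- Multiplication by the matrix `A` on the `d`-dimensional torus. -/
def torusEnd {F : Type*} [Field F] {d : ℕ} (A : Matrix (Fin d) (Fin d) F[X]) :
    (Fin d → TF F) → (Fin d → TF F) :=
  fun x i => ∑ j, polyMulTF (A i j) (x j)

/-- `torusEnd A` is induced by multiplication by `A` on `F((1/t)) ^ d`. -/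
theorem torusEnd_mk {F : Type*} [Field F] {d : ℕ} (A : Matrix (Fin d) (Fin d) F[X])
    (x : Fin d → RF F) :
    torusEnd A (fun i => (x i : TF F)) =
      fun i => ((((A.map (polyToRF F)).mulVec x) i : RF F) : TF F) := by
  funext i
  simp only [torusEnd, Matrix.mulVec, dotProduct, Matrix.map_apply]
  exact (map_sum (QuotientAddGroup.mk' (polyToRF F).toAddMonoidHom.range) _ _).symm

/-- The eigenvalues of `A` in the algebraic closure of `F((1/t))`, with multiplicity. -/
def eigenvaluesBar {F : Type*} [Field F] {d : ℕ} (A : Matrix (Fin d) (Fin d) F[X]) :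
    Multiset (RFbar F) :=
  (A.map ((algebraMap (RF F) (RFbar F)).comp (polyToRF F))).charpoly.roots

/-- `r(A)`, the product of `max(1, |λ|)` over all `d` eigenvalues. -/
def rOf {F : Type*} [Field F] [Finite F] {d : ℕ} (A : Matrix (Fin d) (Fin d) F[X]) : ℝ :=
  ((eigenvaluesBar A).map fun l => max 1 (absBar l)).prod

/-! ### Isolated fixed points and the Artin–Mazur zeta function -/

/-- The isolated fixed points of `f`: the isolated points of the set of fixed points. -/
def isolatedFixedPoints {Y : Type*} [TopologicalSpace Y] (f : Y → Y) : Set Y :=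
  {x | ∃ U : Set Y, IsOpen U ∧ U ∩ Function.fixedPoints f = {x}}

/-- `N_k(f)`, the number of isolated fixed points of `f ^ k` (meaningful when finite). -/
def numIsolated {Y : Type*} [TopologicalSpace Y] (f : Y → Y) (k : ℕ) : ℕ :=
  (isolatedFixedPoints f^[k]).ncard

/-- The series `∑_{k ≥ 1} N_k(f) z ^ k`. -/
def fixedPointSeries {Y : Type*} [TopologicalSpace Y] (f : Y → Y) : PowerSeries ℂ :=
  PowerSeries.mk fun k => if k = 0 then 0 else (numIsolated f k : ℂ)

/-- The Artin–Mazur zeta function `exp (∑_{k ≥ 1} N_k(f) z ^ k / k)`, as a power series. -/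
def artinMazurZeta {Y : Type*} [TopologicalSpace Y] (f : Y → Y) : PowerSeries ℂ :=
  (PowerSeries.exp ℂ).subst
    (PowerSeries.mk fun k => if k = 0 then 0 else (numIsolated f k : ℂ) / (k : ℂ) : PowerSeries ℂ)

/-- The power series `(1 - (r z) ^ L) ^ a` for `L ≥ 1` and rational `a`: the binomial series
`(1 + X) ^ a` at `X = -(r z) ^ L`. -/
def oneSubPow (r : ℝ) (L : ℕ) (a : ℚ) : PowerSeries ℂ :=
  (PowerSeries.binomialSeries ℂ a).subst
    (-(PowerSeries.C (r : ℂ) * PowerSeries.X) ^ L : PowerSeries ℂ)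

/-- A Laurent series is D-finite if its derivatives span a finite-dimensional vector space over
the field of rational functions. -/
def IsDFinite (f : ℂ⸨X⸩) : Prop :=
  FiniteDimensional (RatFunc ℂ)
    (Submodule.span (RatFunc ℂ) (Set.range fun n : ℕ => (LaurentSeries.derivative ℂ)^[n] f))

end

/-!
# Isolated fixed points of toral endomorphisms in positive characteristic

Let `B = A ^ k - 1`. If `det B ≠ 0`, the fixed points of `A ^ k` form the finite group
`B⁻¹ F[t] ^ d / F[t] ^ d`, which has `q ^ deg (det B) = |det B|` elements by the Smith normal form
(`card_quotient_range_mulVec`, `card_fixedPoints`). If `det B = 0`, a polynomial vector in the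
kernel of `B` gives a line of fixed points through each fixed point, so none is isolated. Hence
`N_k = |det (A ^ k - 1)|` (`numIsolated_torusEnd`), which is the product of the `|λ ^ k - 1|` over
the eigenvalues `λ`. This product is evaluated in `norm_det_pow_sub_one`: with `p` the
characteristic,

`N_k = r ^ k * ∏ i, [m_i ∤ k] * ∏ j with n_j ∣ k, b_j ^ (p ^ v_p(k))`, where `0 < b_j < 1`.

The factors of the last kind come from the Frobenius: `λ ^ (n p ^ e) - 1 = (λ ^ n - 1) ^ (p ^ e)`.

If every `n_j` is a multiple of some `m_i`, they never matter, and inclusion-exclusion over the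
conditions `m_i ∣ k` turns the logarithmic derivative of the zeta function into a sum of logarithmic
derivatives of binomial series (`artinMazurZeta_eq_prod`); some power of each of these series is
rational.

Otherwise `N_k / r ^ k = c(k) ^ (p ^ v_p(k))` with `c` periodic of period prime to `p`, and some
value of `c` lies strictly between `0` and `1`. The coefficients of a D-finite series satisfy a
linear recurrence with polynomial coefficients (`IsDFinite.exists_recurrence`). Along an arithmetic
progression on which one term of the recurrence has an index of large `p`-adic valuation `e`, the
other terms do not depend on `e`, whereas that term does; so its coefficient vanishes
(`not_isDFinite_of_coeff_eq`). Finally, if the zeta function `ζ` were algebraic, the field it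
generates over the rational functions would be of finite degree and closed under differentiation,
so that `X ζ' / ζ = ∑ N_k X ^ k` would be D-finite (`HasLogDeriv.isDFinite`).
-/

/-! ### The cokernel of a polynomial matrix and the norm on polynomials -/

open Module in
/-- The index of the image of a matrix of nonzero determinant. -/
theorem card_quotient_range_mulVec {F : Type*} [Field F] [Finite F] {d : ℕ}
    (B : Matrix (Fin d) (Fin d) F[X]) (hB : B.det ≠ 0) :
    Nat.card ((Fin d → F[X]) ⧸ LinearMap.range B.mulVecLin) = Nat.card F ^ B.det.natDegree := by
  classical
  set N := LinearMap.range B.mulVecLin with hN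
  let b := Pi.basisFun F[X] (Fin d)
  have hinj : Function.Injective B.mulVecLin := by
    rw [← LinearMap.ker_eq_bot, Matrix.ker_mulVecLin_eq_bot_iff]
    intro v hv
    by_contra hne
    exact hB (Matrix.exists_mulVec_eq_zero_iff.mp ⟨v, hne, hv⟩)
  let e : (Fin d → F[X]) ≃ₗ[F[X]] N := LinearEquiv.ofInjective _ hinj
  have h : Module.finrank F[X] N = Module.finrank F[X] (Fin d → F[X]) := e.symm.finrank_eq
  let a := Submodule.smithNormalFormCoeffs b h
  let b' := Submodule.smithNormalFormTopBasis b h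
  let ab := Submodule.smithNormalFormBotBasis b h
  have ab_eq := Submodule.smithNormalFormBotBasis_def b h
  let e' : (Fin d → F[X]) ≃ₗ[F[X]] N := b'.equiv ab (Equiv.refl _)
  have ha : ∀ i, (N.subtype ∘ₗ e'.toLinearMap) (b' i) = a i • b' i := by
    intro i
    simp only [LinearMap.comp_apply, LinearEquiv.coe_coe, e', b'.equiv_apply, Equiv.refl_apply]
    exact ab_eq i
  have hdet : LinearMap.det (N.subtype ∘ₗ e'.toLinearMap) = ∏ i, a i := by
    rw [← LinearMap.det_toMatrix b', ← Matrix.det_diagonal]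
    congr 1
    ext1 i j
    rw [LinearMap.toMatrix_apply, ha, map_smul, Basis.repr_self, Finsupp.smul_single,
      smul_eq_mul, mul_one]
    by_cases h : i = j
    · rw [h, Matrix.diagonal_apply_eq, Finsupp.single_eq_same]
    · rw [Matrix.diagonal_apply_ne _ h, Finsupp.single_eq_of_ne h]
  have hassoc : Associated B.det (∏ i, a i) := by
    rw [← hdet]
    have h1 : B.det = LinearMap.det (N.subtype ∘ₗ e.toLinearMap) := by
      rw [show N.subtype ∘ₗ e.toLinearMap = B.mulVecLin from rfl, ← Matrix.toLin'_apply',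
        LinearMap.det_toLin']
    rw [h1]
    exact LinearMap.associated_det_comp_equiv _ _ _
  have ha0 : ∀ i, a i ≠ 0 := Submodule.smithNormalFormCoeffs_ne_zero b h
  have hcyc : ∀ i, Nat.card (F[X] ⧸ Ideal.span ({a i} : Set F[X])) =
      Nat.card F ^ (a i).natDegree := by
    intro i
    have : Module.Finite F (F[X] ⧸ Ideal.span ({a i} : Set F[X])) :=
      PowerBasis.finite (AdjoinRoot.powerBasis (ha0 i))
    rw [Module.natCard_eq_pow_finrank (K := F), finrank_quotient_span_eq_natDegree]
  rw [Nat.card_congr (Submodule.quotientEquivPiSpan N b h).toEquiv, Nat.card_pi,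
    Polynomial.natDegree_eq_of_degree_eq (Polynomial.degree_eq_degree_of_associated hassoc),
    Polynomial.natDegree_prod _ _ (fun i _ => ha0 i), ← Finset.prod_pow_eq_pow_sum]
  exact Finset.prod_congr rfl fun i _ => hcyc i

section PolyNorm

variable {F : Type*} [Field F]

theorem polyToRF_coeff (p : F[X]) (m : ℕ) : (polyToRF F p).coeff (-(m : ℤ)) = p.coeff m := by
  induction p using Polynomial.induction_on' with
  | add p q hp hq => simp [hp, hq]
  | monomial n a =>
    simp only [polyToRF, Polynomial.coe_eval₂RingHom, Polynomial.eval₂_monomial,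
      HahnSeries.single_pow, one_pow, HahnSeries.C_mul_eq_smul, HahnSeries.coeff_smul,
      Polynomial.coeff_monomial, HahnSeries.coeff_single]
    by_cases h : n = m
    · simp [h]
    · simp [h, Ne.symm h]

theorem polyToRF_injective : Function.Injective (polyToRF F) := by
  intro p q h
  ext m
  rw [← polyToRF_coeff, h, polyToRF_coeff]

theorem order_polyToRF {p : F[X]} (hp : p ≠ 0) : (polyToRF F p).order = -(p.natDegree : ℤ) := by
  have h0 : polyToRF F p ≠ 0 := fun h => hp (polyToRF_injective (h.trans (map_zero _).symm))
  apply le_antisymm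
  · apply HahnSeries.order_le_of_coeff_ne_zero
    rw [polyToRF_coeff]
    simpa using hp
  · by_contra! hlt
    have h1 := HahnSeries.coeff_order_eq_zero.not.mpr h0
    obtain ⟨m, hm⟩ : ∃ m : ℕ, (polyToRF F p).order = -(m : ℤ) :=
      ⟨((polyToRF F p).order).natAbs, by omega⟩
    rw [hm, polyToRF_coeff] at h1
    exact h1 (Polynomial.coeff_eq_zero_of_natDegree_lt (by omega))

variable [Finite F]

theorem norm_polyToRF {p : F[X]} (hp : p ≠ 0) :
    ‖polyToRF F p‖ = (Nat.card F : ℝ) ^ p.natDegree := by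
  rw [norm_RF (fun h => hp (polyToRF_injective (h.trans (map_zero _).symm))), order_polyToRF hp]
  simp

theorem one_le_norm_polyToRF {p : F[X]} (hp : p ≠ 0) : 1 ≤ ‖polyToRF F p‖ := by
  rw [norm_polyToRF hp]
  exact one_le_pow₀ (by exact_mod_cast (Finite.one_lt_card (α := F)).le)

theorem isUltrametricDist_RF : IsUltrametricDist (RF F) :=
  inferInstanceAs (@IsUltrametricDist (RF F)
    (Valued.toNormedField (RF F) (WithZero (Multiplicative ℤ))).toDist)

/-- The Laurent series field as a nontrivially normed field. -/
@[reducible] noncomputable def nontriviallyNormedFieldRF : NontriviallyNormedField (RF F) :=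
  { normedFieldRF F with
    non_trivial := by
      refine ⟨polyToRF F Polynomial.X, ?_⟩
      rw [norm_polyToRF Polynomial.X_ne_zero]
      simpa using (Finite.one_lt_card (α := F)) }

theorem isClosed_range_polyToRF :
    IsClosed ((polyToRF F).toAddMonoidHom.range : Set (RF F)) := by
  have hd : DiscreteTopology (polyToRF F).toAddMonoidHom.range := by
    refine DiscreteTopology.of_forall_le_dist (r := 1) one_pos ?_
    rintro ⟨_, p, rfl⟩ ⟨_, q, rfl⟩ hne
    rw [Subtype.dist_eq, dist_eq_norm]
    change 1 ≤ ‖polyToRF F p - polyToRF F q‖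
    rw [← map_sub]
    apply one_le_norm_polyToRF
    rw [sub_ne_zero]
    rintro rfl
    exact hne rfl
  exact AddSubgroup.isClosed_of_discrete

end PolyNorm

/-! ### Fixed points on the torus -/

section Torus

open Topology

variable {F : Type*} [Field F] {d : ℕ}

/-- The projection `F((1/t)) ^ d → 𝕋 ^ d`. -/
noncomputable def torusProj (F : Type*) [Field F] (d : ℕ) : (Fin d → RF F) →+ (Fin d → TF F) where
  toFun x i := (x i : TF F)
  map_zero' := rfl
  map_add' _ _ := rfl

theorem torusProj_surjective : Function.Surjective (torusProj F d) := by
  intro y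
  choose x hx using fun i => QuotientAddGroup.mk_surjective (y i)
  exact ⟨x, funext hx⟩

theorem torusProj_eq_zero_iff {x : Fin d → RF F} :
    torusProj F d x = 0 ↔ ∃ p : Fin d → F[X], (fun i => polyToRF F (p i)) = x := by
  constructor
  · intro h
    have h1 : ∀ i, ∃ p : F[X], polyToRF F p = x i := fun i =>
      (QuotientAddGroup.eq_zero_iff (x i)).mp (congrFun h i)
    choose p hp using h1
    exact ⟨p, funext hp⟩
  · rintro ⟨p, rfl⟩
    funext i
    exact (QuotientAddGroup.eq_zero_iff _).mpr ⟨p i, rfl⟩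

theorem torusEnd_torusProj (A : Matrix (Fin d) (Fin d) F[X]) (x : Fin d → RF F) :
    torusEnd A (torusProj F d x) = torusProj F d ((A.map (polyToRF F)).mulVec x) :=
  torusEnd_mk A x

theorem torusEnd_iterate (A : Matrix (Fin d) (Fin d) F[X]) (k : ℕ) :
    (torusEnd A)^[k] = torusEnd (A ^ k) := by
  induction k with
  | zero =>
    funext y
    obtain ⟨x, rfl⟩ := torusProj_surjective y
    rw [torusEnd_torusProj]
    simp [Matrix.map_one]
  | succ k ih =>
    funext y
    obtain ⟨x, rfl⟩ := torusProj_surjective y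
    rw [Function.iterate_succ_apply, torusEnd_torusProj, ih, torusEnd_torusProj,
      torusEnd_torusProj, Matrix.mulVec_mulVec, ← Matrix.map_mul, pow_succ]

/-- A point of `F((1/t)) ^ d` represents a fixed point of `C` if and only if `C - 1` maps it to a
polynomial vector. -/
theorem torusProj_mem_fixedPoints (C : Matrix (Fin d) (Fin d) F[X]) (x : Fin d → RF F) :
    torusProj F d x ∈ Function.fixedPoints (torusEnd C) ↔
      torusProj F d (((C - 1).map (polyToRF F)).mulVec x) = 0 := by
  rw [Function.mem_fixedPoints, Function.IsFixedPt, torusEnd_torusProj, ← sub_eq_zero, ← map_sub,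
    Matrix.map_sub _ (map_sub _), Matrix.sub_mulVec]
  simp [Matrix.map_one]

/-- If `det (C - 1) ≠ 0`, the fixed points of `C` form the group
`(C - 1)⁻¹ F[t] ^ d / F[t] ^ d`, of order `|det (C - 1)|`. -/
theorem card_fixedPoints [Finite F] (C : Matrix (Fin d) (Fin d) F[X]) (hC : (C - 1).det ≠ 0) :
    Nat.card (Function.fixedPoints (torusEnd C)) = Nat.card F ^ (C - 1).det.natDegree := by
  set B := C - 1 with hB
  set B' := B.map (polyToRF F) with hB'
  have hdet : IsUnit B'.det := by
    rw [hB', ← RingHom.mapMatrix_apply, ← RingHom.map_det, isUnit_iff_ne_zero]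
    exact fun h => hC (polyToRF_injective (h.trans (map_zero _).symm))
  let φ : (Fin d → F[X]) →+ (Fin d → TF F) := (torusProj F d).comp
    { toFun := fun p => B'⁻¹.mulVec fun i => polyToRF F (p i)
      map_zero' := by
        rw [← Matrix.mulVec_zero B'⁻¹]
        congr 1
        funext i
        simp
      map_add' := by
        intro p q
        rw [← Matrix.mulVec_add]
        congr 1
        funext i
        simp }
  have hmul : ∀ p : Fin d → F[X], B'.mulVec (fun i => polyToRF F (p i)) =
      fun i => polyToRF F (B.mulVec p i) := fun p => by
    funext i
    exact ((polyToRF F).map_mulVec B p i).symm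
  have hrange : (φ.range : Set (Fin d → TF F)) = Function.fixedPoints (torusEnd C) := by
    ext y
    obtain ⟨x, rfl⟩ := torusProj_surjective y
    rw [torusProj_mem_fixedPoints, ← hB, ← hB', torusProj_eq_zero_iff]
    constructor
    · rintro ⟨p, hp⟩
      have h1 : torusProj F d (x - B'⁻¹.mulVec fun i => polyToRF F (p i)) = 0 := by
        rw [map_sub, sub_eq_zero]
        exact hp.symm
      obtain ⟨u, hu⟩ := torusProj_eq_zero_iff.mp h1
      refine ⟨p + B.mulVec u, ?_⟩
      rw [sub_eq_iff_eq_add.mp hu.symm, Matrix.mulVec_add, Matrix.mulVec_mulVec,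
        Matrix.mul_nonsing_inv _ hdet, Matrix.one_mulVec, hmul]
      funext i
      simp [add_comm]
    · rintro ⟨p, hp⟩
      refine ⟨p, ?_⟩
      change torusProj F d (B'⁻¹.mulVec fun i => polyToRF F (p i)) = _
      rw [hp, Matrix.mulVec_mulVec,
        Matrix.nonsing_inv_mul _ hdet, Matrix.one_mulVec]
  have hker : φ.ker = (LinearMap.range B.mulVecLin).toAddSubgroup := by
    ext p
    rw [AddMonoidHom.mem_ker]
    change torusProj F d (B'⁻¹.mulVec fun i => polyToRF F (p i)) = 0 ↔ _
    rw [torusProj_eq_zero_iff]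
    constructor
    · rintro ⟨u, hu⟩
      refine ⟨u, ?_⟩
      have h1 := congrArg B'.mulVec hu
      rw [Matrix.mulVec_mulVec, Matrix.mul_nonsing_inv _ hdet, Matrix.one_mulVec, hmul] at h1
      funext i
      exact polyToRF_injective (congrFun h1 i)
    · rintro ⟨u, rfl⟩
      refine ⟨u, ?_⟩
      rw [Matrix.mulVecLin_apply, ← hmul, Matrix.mulVec_mulVec, Matrix.nonsing_inv_mul _ hdet,
        Matrix.one_mulVec]
  rw [← hrange, ← card_quotient_range_mulVec B hC]
  change Nat.card φ.range = _
  rw [← Nat.card_congr (QuotientAddGroup.quotientKerEquivRange φ).toEquiv]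
  exact Nat.card_congr (QuotientAddGroup.quotientAddEquivOfEq hker).toEquiv

variable [Finite F]

theorem isolatedFixedPoints_eq_of_finite {Y : Type*} [TopologicalSpace Y] [T1Space Y] {f : Y → Y}
    (hf : (Function.fixedPoints f).Finite) : isolatedFixedPoints f = Function.fixedPoints f := by
  ext x
  constructor
  · rintro ⟨U, -, hU⟩
    exact (hU.symm ▸ Set.mem_singleton x : x ∈ U ∩ Function.fixedPoints f).2
  · intro hx
    refine ⟨(Function.fixedPoints f \ {x})ᶜ, (hf.subset Set.sdiff_subset).isClosed.isOpen_compl, ?_⟩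
    ext y
    simp only [Set.mem_inter_iff, Set.mem_compl_iff, Set.mem_sdiff, Set.mem_singleton_iff]
    constructor
    · tauto
    · rintro rfl
      tauto

instance t1Space_TF : T1Space (TF F) :=
  haveI : IsClosed ((polyToRF F).toAddMonoidHom.range : Set (RF F)) := isClosed_range_polyToRF
  inferInstance

theorem isolatedFixedPoints_torusEnd_of_det_ne_zero (C : Matrix (Fin d) (Fin d) F[X])
    (hC : (C - 1).det ≠ 0) :
    (isolatedFixedPoints (torusEnd C)).Finite ∧
      ((isolatedFixedPoints (torusEnd C)).ncard : ℝ) = ‖polyToRF F (C - 1).det‖ := by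
  have hcard := card_fixedPoints C hC
  have hfin : (Function.fixedPoints (torusEnd C)).Finite := by
    refine Nat.finite_of_card_ne_zero ?_
    rw [hcard]
    exact pow_ne_zero _ Nat.card_pos.ne'
  rw [isolatedFixedPoints_eq_of_finite hfin]
  refine ⟨hfin, ?_⟩
  rw [← Nat.card_coe_set_eq, hcard, norm_polyToRF hC]
  push_cast
  rfl

/-- If `det (C - 1) = 0`, every fixed point lies on a line of fixed points, the direction of which
is a vector of the kernel of `C - 1`. -/
theorem isolatedFixedPoints_torusEnd_of_det_eq_zero (C : Matrix (Fin d) (Fin d) F[X])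
    (hC : (C - 1).det = 0) : isolatedFixedPoints (torusEnd C) = ∅ := by
  obtain ⟨v, hv0, hv⟩ := Matrix.exists_mulVec_eq_zero_iff.mpr hC
  obtain ⟨i, hi⟩ := Function.ne_iff.mp hv0
  rw [Set.eq_empty_iff_forall_notMem]
  rintro y ⟨U, hUo, hU⟩
  have hy : y ∈ U ∩ Function.fixedPoints (torusEnd C) := hU.symm ▸ Set.mem_singleton y
  obtain ⟨x, rfl⟩ := torusProj_surjective y
  let w : Fin d → RF F := fun j => polyToRF F (v j)
  let ψ : RF F → (Fin d → TF F) := fun s => torusProj F d (x + s • w)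
  have hcont : Continuous ψ := by
    refine continuous_pi fun j => ?_
    change Continuous fun s : RF F => ((x j + s * w j : RF F) : TF F)
    have h : Continuous fun s : RF F => x j + s * w j :=
      continuous_const.add (continuous_id.mul continuous_const)
    exact continuous_quot_mk.comp h
  have hw : ((C - 1).map (polyToRF F)).mulVec w = 0 := by
    funext j
    rw [show w = polyToRF F ∘ v from rfl, ← (polyToRF F).map_mulVec (C - 1) v j, hv]
    simp
  have hfix : ∀ s, ψ s ∈ Function.fixedPoints (torusEnd C) := by
    intro s
    rw [torusProj_mem_fixedPoints, Matrix.mulVec_add, Matrix.mulVec_smul, hw, smul_zero, add_zero]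
    exact (torusProj_mem_fixedPoints C x).mp hy.2
  have hnhds : ∀ᶠ s in 𝓝 (0 : RF F), ψ s ∈ U := by
    refine hcont.continuousAt.eventually_mem (hUo.mem_nhds ?_)
    simpa [ψ] using hy.1
  have hsmall : ∀ᶠ s in 𝓝 (0 : RF F), ‖s * w i‖ < 1 := by
    have : Continuous fun s : RF F => ‖s * w i‖ :=
      (continuous_id.mul continuous_const).norm
    refine this.continuousAt.eventually_lt_const ?_
    simp
  have : (𝓝[≠] (0 : RF F)).NeBot :=
    @NormedField.nhdsNE_neBot (RF F) nontriviallyNormedFieldRF 0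
  obtain ⟨s, ⟨hsU, hs1⟩, hs0⟩ :=
    (((hnhds.and hsmall).filter_mono nhdsWithin_le_nhds).and
      (self_mem_nhdsWithin : {(0 : RF F)}ᶜ ∈ 𝓝[≠] (0 : RF F))).exists
  have heq : ψ s = torusProj F d x := by
    have : ψ s ∈ U ∩ Function.fixedPoints (torusEnd C) := ⟨hsU, hfix s⟩
    rw [hU] at this
    exact this
  have h1 : torusProj F d (s • w) = 0 := by
    have : torusProj F d x + torusProj F d (s • w) = torusProj F d x := by
      rw [← map_add]
      exact heq
    exact add_eq_left.mp this
  obtain ⟨p, hp⟩ := torusProj_eq_zero_iff.mp h1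
  have hpi : polyToRF F (p i) = s * w i := congrFun hp i
  have hwi : w i ≠ 0 := fun h => hi (polyToRF_injective (h.trans (map_zero _).symm))
  have hpi0 : p i ≠ 0 := by
    intro h
    rw [h, map_zero] at hpi
    exact (mul_ne_zero hs0 hwi) hpi.symm
  have := one_le_norm_polyToRF hpi0
  rw [hpi] at this
  exact absurd hs1 (not_lt.mpr this)

/-- The number of isolated fixed points of `A ^ k` is `|det (A ^ k - 1)|`. -/
theorem numIsolated_torusEnd (A : Matrix (Fin d) (Fin d) F[X]) (k : ℕ) :
    (isolatedFixedPoints (torusEnd A)^[k]).Finite ∧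
      (numIsolated (torusEnd A) k : ℝ) = ‖polyToRF F (A ^ k - 1).det‖ := by
  rw [numIsolated, torusEnd_iterate]
  by_cases h : (A ^ k - 1).det = 0
  · rw [isolatedFixedPoints_torusEnd_of_det_eq_zero _ h, h]
    simp
  · exact isolatedFixedPoints_torusEnd_of_det_ne_zero _ h

end Torus

/-! ### The absolute value on the algebraic closure and constant terms -/

theorem one_le_multiset_prod {s : Multiset ℝ} (h : ∀ x ∈ s, 1 ≤ x) : 1 ≤ s.prod := by
  induction s using Multiset.induction_on with
  | empty => simp
  | cons a s ih =>
    rw [Multiset.prod_cons]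
    exact one_le_mul_of_one_le_of_one_le (h a (Multiset.mem_cons_self a s))
      (ih fun x hx => h x (Multiset.mem_cons_of_mem hx))

section AbsBar

variable {F : Type*} [Field F] [Finite F]

/-- The absolute value on the algebraic closure, as a bundled multiplicative norm. -/
noncomputable def absBarHom (F : Type*) [Field F] [Finite F] : RFbar F →*₀ ℝ :=
  letI : NontriviallyNormedField (RF F) := nontriviallyNormedFieldRF
  haveI : IsUltrametricDist (RF F) := isUltrametricDist_RF
  haveI : CompleteSpace (RF F) := LaurentSeries.instLaurentSeriesComplete
  { toFun := absBar
    map_zero' := map_zero (spectralMulAlgNorm (RF F) (RFbar F))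
    map_one' := map_one (spectralMulAlgNorm (RF F) (RFbar F))
    map_mul' := map_mul (spectralMulAlgNorm (RF F) (RFbar F)) }

theorem absBar_mul (x y : RFbar F) : absBar (x * y) = absBar x * absBar y :=
  map_mul (absBarHom F) x y

theorem absBar_zero : absBar (0 : RFbar F) = 0 := map_zero (absBarHom F)

theorem absBar_one : absBar (1 : RFbar F) = 1 := map_one (absBarHom F)

theorem absBar_pow (x : RFbar F) (n : ℕ) : absBar (x ^ n) = absBar x ^ n :=
  map_pow (absBarHom F) x n

theorem absBar_nonneg (x : RFbar F) : 0 ≤ absBar x := spectralNorm_nonneg x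

theorem absBar_multiset_prod (s : Multiset (RFbar F)) :
    absBar s.prod = (s.map absBar).prod := map_multiset_prod (absBarHom F) s

theorem absBar_pos {x : RFbar F} (hx : x ≠ 0) : 0 < absBar x :=
  spectralNorm_zero_lt hx (Algebra.IsAlgebraic.isAlgebraic x)

theorem absBar_neg (x : RFbar F) : absBar (-x) = absBar x :=
  spectralNorm_neg (Algebra.IsAlgebraic.isAlgebraic x)

theorem absBar_sub_comm (x y : RFbar F) : absBar (x - y) = absBar (y - x) := by
  rw [← absBar_neg, neg_sub]

theorem absBar_add_le_max (x y : RFbar F) : absBar (x + y) ≤ max (absBar x) (absBar y) :=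
  haveI : IsUltrametricDist (RF F) := isUltrametricDist_RF
  isNonarchimedean_spectralNorm x y

theorem absBar_sub_le_max (x y : RFbar F) : absBar (x - y) ≤ max (absBar x) (absBar y) := by
  rw [sub_eq_add_neg, ← absBar_neg y]
  exact absBar_add_le_max _ _

theorem absBar_algebraMap (x : RF F) : absBar (algebraMap (RF F) (RFbar F) x) = ‖x‖ :=
  haveI : IsUltrametricDist (RF F) := isUltrametricDist_RF
  spectralNorm_extends x

theorem absBar_sub_eq_of_lt {x y : RFbar F} (h : absBar y < absBar x) :
    absBar (x - y) = absBar x := by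
  refine le_antisymm ((absBar_sub_le_max x y).trans (max_le le_rfl h.le)) ?_
  have h1 := absBar_add_le_max (x - y) y
  rw [sub_add_cancel] at h1
  rcases le_max_iff.mp h1 with h2 | h2
  · exact h2
  · exact absurd h (not_lt.mpr h2)

theorem absBar_sum_lt {ι : Type*} (s : Finset ι) (f : ι → RFbar F) {c : ℝ} (hc : 0 < c)
    (h : ∀ i ∈ s, absBar (f i) < c) : absBar (∑ i ∈ s, f i) < c := by
  classical
  induction s using Finset.induction_on with
  | empty => simpa [absBar_zero] using hc
  | insert i s hi ih =>
    rw [Finset.sum_insert hi]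
    exact (absBar_add_le_max _ _).trans_lt (max_lt (h i (Finset.mem_insert_self i s))
      (ih fun j hj => h j (Finset.mem_insert_of_mem hj)))

theorem absBar_eq_one_of_isOfFinOrder {x : RFbar F} (hx : IsOfFinOrder x) : absBar x = 1 := by
  obtain ⟨n, hn, h⟩ := isOfFinOrder_iff_pow_eq_one.mp hx
  rw [← pow_eq_one_iff_of_nonneg (absBar_nonneg x) hn.ne', ← absBar_pow, h, absBar_one]

/-- The embedding of the constant field. -/
noncomputable def constEmb (F : Type*) [Field F] : F →+* RFbar F :=
  (algebraMap (RF F) (RFbar F)).comp HahnSeries.C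

/-- The roots of polynomials over the finite field `F` are `0` and the roots of unity. -/
theorem eq_zero_or_isOfFinOrder_iff (x : RFbar F) :
    (x = 0 ∨ IsOfFinOrder x) ↔ (constEmb F).IsIntegralElem x := by
  constructor
  · rintro (rfl | h)
    · exact (constEmb F).isIntegralElem_zero
    · obtain ⟨n, hn, h⟩ := isOfFinOrder_iff_pow_eq_one.mp h
      exact ⟨Polynomial.X ^ n - Polynomial.C 1, Polynomial.monic_X_pow_sub_C 1 hn.ne', by simp [h]⟩
  · intro h
    by_cases hx : x = 0
    · exact Or.inl hx
    refine Or.inr ?_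
    let : Algebra F (RFbar F) := (constEmb F).toAlgebra
    have hint : IsIntegral F x := h
    have : Module.Finite F (IntermediateField.adjoin F {x}) :=
      IntermediateField.adjoin.finiteDimensional hint
    have : Finite (IntermediateField.adjoin F {x}) := Module.finite_of_finite F
    have hgen : IntermediateField.AdjoinSimple.gen F x ≠ 0 := by
      intro h0
      apply hx
      rw [← IntermediateField.AdjoinSimple.coe_gen F x, h0]
      rfl
    have h1 : IsOfFinOrder (Units.mk0 _ hgen) := isOfFinOrder_of_finite _
    obtain ⟨n, hn, h1⟩ := isOfFinOrder_iff_pow_eq_one.mp h1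
    refine isOfFinOrder_iff_pow_eq_one.mpr ⟨n, hn, ?_⟩
    have h2 := congrArg (fun u : (IntermediateField.adjoin F {x})ˣ =>
      ((u : IntermediateField.adjoin F {x}) : RFbar F)) h1
    simpa using h2

theorem IsConstantTerm.unique {x a b : RFbar F} (ha : IsConstantTerm x a)
    (hb : IsConstantTerm x b) : a = b := by
  have hab : absBar (a - b) < 1 := by
    rw [show a - b = (x - b) - (x - a) by ring]
    exact (absBar_sub_le_max _ _).trans_lt (max_lt hb.2 ha.2)
  have h := (eq_zero_or_isOfFinOrder_iff (a - b)).mpr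
    (RingHom.IsIntegralElem.sub _ ((eq_zero_or_isOfFinOrder_iff a).mp ha.1)
      ((eq_zero_or_isOfFinOrder_iff b).mp hb.1))
  rcases h with h | h
  · exact sub_eq_zero.mp h
  · exact absurd (absBar_eq_one_of_isOfFinOrder h) hab.ne

/-- A series of norm at most one is congruent to its constant coefficient. -/
theorem norm_sub_C_coeff_lt {x : RF F} (hx : ‖x‖ ≤ 1) : ‖x - HahnSeries.C (x.coeff 0)‖ < 1 := by
  have hq : (1 : ℝ) < Nat.card F := by exact_mod_cast Finite.one_lt_card (α := F)
  have hneg : ∀ n : ℤ, n < 0 → x.coeff n = 0 := by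
    intro n hn
    by_cases h0 : x = 0
    · simp [h0]
    rw [norm_RF h0, ← zpow_zero (Nat.card F : ℝ), zpow_le_zpow_iff_right₀ hq] at hx
    exact HahnSeries.coeff_eq_zero_of_lt_order (by omega)
  by_cases h0 : x - HahnSeries.C (x.coeff 0) = 0
  · rw [h0, norm_zero]
    exact one_pos
  rw [norm_RF h0, ← zpow_zero (Nat.card F : ℝ), zpow_lt_zpow_iff_right₀ hq]
  by_contra! hle
  apply HahnSeries.coeff_order_eq_zero.not.mpr h0
  have hle' : (x - HahnSeries.C (x.coeff 0)).order ≤ 0 := by omega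
  rcases hle'.lt_or_eq with h | h
  · rw [HahnSeries.coeff_sub, hneg _ h, zero_sub, neg_eq_zero]
    exact HahnSeries.coeff_single_of_ne h.ne
  · rw [h]
    simp

/-- Reducing the coefficients of the minimal polynomial of `x` modulo the maximal ideal gives a
polynomial over `F`; one of its roots is congruent to `x`. -/
theorem exists_isConstantTerm {x : RFbar F} (hx : absBar x ≤ 1) : ∃ a, IsConstantTerm x a := by
  set P := minpoly (RF F) x with hP
  have hint : IsIntegral (RF F) x := Algebra.IsIntegral.isIntegral x
  have hmonic : P.Monic := minpoly.monic hint
  have hcoeff : ∀ n, ‖P.coeff n‖ ≤ 1 := (spectralValue_le_one_iff hmonic).mp hx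
  set n := P.natDegree with hn
  let g : F[X] := Polynomial.X ^ n +
    ∑ i ∈ Finset.range n, Polynomial.monomial i ((P.coeff i).coeff 0)
  have hgmonic : g.Monic := by
    refine Polynomial.monic_X_pow_add ?_
    refine Polynomial.mem_degreeLT.mp
      (Submodule.sum_mem _ fun i hi => Polynomial.mem_degreeLT.mpr ?_)
    exact (Polynomial.degree_monomial_le _ _).trans_lt (by exact_mod_cast Finset.mem_range.mp hi)
  -- `g` differs from the minimal polynomial by coefficients in the maximal ideal
  have hgx : absBar (g.eval₂ (constEmb F) x) < 1 := by
    have h0 : ∑ i ∈ Finset.range (n + 1), algebraMap (RF F) (RFbar F) (P.coeff i) * x ^ i = 0 := by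
      have := minpoly.aeval (RF F) x
      rw [← hP, Polynomial.aeval_eq_sum_range] at this
      simpa [Algebra.smul_def] using this
    rw [Finset.sum_range_succ, hn, hmonic.coeff_natDegree, map_one, one_mul, ← hn] at h0
    have h1 : g.eval₂ (constEmb F) x = -∑ i ∈ Finset.range n,
        (algebraMap (RF F) (RFbar F) (P.coeff i - HahnSeries.C ((P.coeff i).coeff 0)) * x ^ i) := by
      simp only [g, Polynomial.eval₂_add, Polynomial.eval₂_X_pow, Polynomial.eval₂_finsetSum,
        Polynomial.eval₂_monomial, map_sub, sub_mul, Finset.sum_sub_distrib]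
      rw [eq_neg_of_add_eq_zero_right h0]
      simp only [constEmb, RingHom.comp_apply]
      ring
    rw [h1, absBar_neg]
    refine absBar_sum_lt _ _ one_pos fun i _ => ?_
    rw [absBar_mul, absBar_algebraMap, absBar_pow]
    exact (mul_le_of_le_one_right (norm_nonneg _) (pow_le_one₀ (absBar_nonneg x) hx)).trans_lt
      (norm_sub_C_coeff_lt (hcoeff i))
  have hsplit := IsAlgClosed.splits (g.map (constEmb F))
  have hprod := hsplit.eq_prod_roots_of_monic (hgmonic.map _)
  rw [← Polynomial.eval_map, hprod, Polynomial.eval_multiset_prod, absBar_multiset_prod] at hgx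
  by_contra! hcon
  refine absurd hgx (not_lt.mpr ?_)
  rw [Multiset.map_map, Multiset.map_map]
  refine one_le_multiset_prod ?_
  intro c hc
  obtain ⟨a, ha, rfl⟩ := Multiset.mem_map.mp hc
  have hroot : (constEmb F).IsIntegralElem a := by
    refine ⟨g, hgmonic, ?_⟩
    rw [← Polynomial.eval_map]
    exact (Polynomial.mem_roots'.mp ha).2
  by_contra! hlt
  refine hcon a ⟨(eq_zero_or_isOfFinOrder_iff a).mpr hroot, ?_⟩
  simpa using hlt

theorem constantTerm_spec {x : RFbar F} (hx : absBar x ≤ 1) :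
    IsConstantTerm x (constantTerm x) :=
  Classical.epsilon_spec (exists_isConstantTerm hx)

theorem constantTerm_eq {x a : RFbar F} (h : IsConstantTerm x a) : constantTerm x = a :=
  (Classical.epsilon_spec (p := fun a => IsConstantTerm x a) ⟨a, h⟩ :
    IsConstantTerm x (constantTerm x)).unique h

end AbsBar

/-! ### The product formula for the number of isolated fixed points -/

open Polynomial in
/-- The determinant of a polynomial in `M` is the product of its values at the eigenvalues. -/
theorem det_aeval_prod_X_sub_C {K : Type*} [Field K] [IsAlgClosed K] {d : ℕ}
    (M : Matrix (Fin d) (Fin d) K) (s : Multiset K) :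
    (aeval M (s.map fun z => X - C z).prod).det =
      (M.charpoly.roots.map fun l => ((s.map fun z => X - C z).prod).eval l).prod := by
  induction s using Multiset.induction_on with
  | empty => simp
  | cons z s ih =>
    have hs := IsAlgClosed.splits M.charpoly
    -- the signs of `det (M - z) = ± det (z - M)` and `∏ (l - z) = ± ∏ (z - l)` agree, since there
    -- are `d` eigenvalues
    have hz : (aeval M (X - C z)).det = (M.charpoly.roots.map fun l => (X - C z).eval l).prod := by
      have h1 : aeval M (X - C z) = -(Matrix.scalar (Fin d) z - M) := by
        simp [Matrix.algebraMap_eq_diagonal]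
      have h2 : M.charpoly.eval z = (M.charpoly.roots.map fun l => z - l).prod := by
        conv_lhs => rw [hs.eq_prod_roots_of_monic M.charpoly_monic]
        rw [eval_multiset_prod, Multiset.map_map]
        simp
      have h3 : (M.charpoly.roots.map fun l => (X - C z).eval l) =
          (M.charpoly.roots.map fun l => z - l).map Neg.neg := by
        rw [Multiset.map_map]
        simp
      rw [h1, Matrix.det_neg, ← Matrix.eval_charpoly, h2, h3, Multiset.prod_map_neg,
        Multiset.card_map, ← hs.natDegree_eq_card_roots, M.charpoly_natDegree_eq_dim]
    simp only [Multiset.map_cons, Multiset.prod_cons, map_mul, Matrix.det_mul, eval_mul,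
      Multiset.prod_map_mul, ih, hz]

open Polynomial in
theorem det_pow_sub_one {K : Type*} [Field K] [IsAlgClosed K] {d : ℕ}
    (M : Matrix (Fin d) (Fin d) K) {k : ℕ} (hk : k ≠ 0) :
    (M ^ k - 1).det = (M.charpoly.roots.map fun l => l ^ k - 1).prod := by
  have hm : (X ^ k - C 1 : K[X]).Monic := monic_X_pow_sub_C 1 hk
  have h := det_aeval_prod_X_sub_C M (X ^ k - C 1 : K[X]).roots
  rw [← (IsAlgClosed.splits (X ^ k - C 1 : K[X])).eq_prod_roots_of_monic hm] at h
  simpa using h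

theorem prod_map_filter_eq_ite {α M : Type*} [CommMonoid M] (s : Multiset α) (P : α → Prop)
    [DecidablePred P] (f : α → M) :
    ((s.filter P).map f).prod = (s.map fun x => if P x then f x else 1).prod := by
  induction s using Multiset.induction_on with
  | empty => simp
  | cons a s ih => by_cases h : P a <;> simp [h, ih]

section UnitNorm

variable {F : Type*} [Field F] [Finite F]

theorem absBar_pow_sub_pow_lt {x a : RFbar F} (hx : absBar x ≤ 1) (ha : absBar a ≤ 1)
    (h : absBar (x - a) < 1) (k : ℕ) : absBar (x ^ k - a ^ k) < 1 := by
  induction k with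
  | zero => simp [absBar_zero]
  | succ k ih =>
    rw [show x ^ (k + 1) - a ^ (k + 1) = x ^ k * (x - a) + (x ^ k - a ^ k) * a by ring]
    refine (absBar_add_le_max _ _).trans_lt (max_lt ?_ ?_)
    · rw [absBar_mul, absBar_pow]
      exact (mul_le_of_le_one_left (absBar_nonneg _) (pow_le_one₀ (absBar_nonneg x) hx)).trans_lt h
    · rw [absBar_mul]
      exact (mul_le_of_le_one_right (absBar_nonneg _) ha).trans_lt ih

theorem isOfFinOrder_constantTerm {x : RFbar F} (hx : absBar x = 1) :
    IsOfFinOrder (constantTerm x) := by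
  have h := constantTerm_spec hx.le
  rcases h.1 with h0 | h0
  · have h2 := h.2
    rw [h0, sub_zero, hx] at h2
    exact absurd h2 (lt_irrefl _)
  · exact h0

theorem orderMod_pos {x : RFbar F} (hx : absBar x = 1) : 0 < orderMod x :=
  (isOfFinOrder_constantTerm hx).orderOf_pos

theorem absBar_pow_sub_one_lt {x : RFbar F} (hx : absBar x = 1) {k : ℕ} (hk : orderMod x ∣ k) :
    absBar (x ^ k - 1) < 1 := by
  have ha := absBar_eq_one_of_isOfFinOrder (isOfFinOrder_constantTerm hx)
  have h := absBar_pow_sub_pow_lt hx.le ha.le (constantTerm_spec hx.le).2 k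
  rwa [orderOf_dvd_iff_pow_eq_one.mp hk] at h

theorem absBar_eq_one_of_isIntegralElem {x : RFbar F} (hx : (constEmb F).IsIntegralElem x)
    (h0 : x ≠ 0) : absBar x = 1 :=
  absBar_eq_one_of_isOfFinOrder (((eq_zero_or_isOfFinOrder_iff x).mpr hx).resolve_left h0)

theorem absBar_pow_sub_one_of_not_dvd {x : RFbar F} (hx : absBar x = 1) {k : ℕ}
    (hk : ¬ orderMod x ∣ k) : absBar (x ^ k - 1) = 1 := by
  set a := constantTerm x with hadef
  have hfin := isOfFinOrder_constantTerm hx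
  have ha := absBar_eq_one_of_isOfFinOrder hfin
  have h := absBar_pow_sub_pow_lt hx.le ha.le (constantTerm_spec hx.le).2 k
  have hak : a ^ k - 1 ≠ 0 := fun h0 =>
    hk (orderOf_dvd_iff_pow_eq_one.mpr (sub_eq_zero.mp h0))
  have h1 : absBar (a ^ k - 1) = 1 := by
    refine absBar_eq_one_of_isIntegralElem ?_ hak
    exact RingHom.IsIntegralElem.sub _
      ((eq_zero_or_isOfFinOrder_iff _).mp (Or.inr hfin.pow)) (constEmb F).isIntegralElem_one
  rw [show x ^ k - 1 = (a ^ k - 1) - (a ^ k - x ^ k) by ring, absBar_sub_eq_of_lt, h1]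
  rwa [h1, absBar_sub_comm]

theorem not_dvd_orderMod (p : ℕ) [Fact p.Prime] [CharP F p] {x : RFbar F} (hx : absBar x = 1) :
    ¬ p ∣ orderMod x := by
  have : CharP (RFbar F) p := charP_of_injective_ringHom (constEmb F).injective p
  rintro ⟨m, hm⟩
  have hpos := orderMod_pos hx
  have h1 : constantTerm x ^ m = 1 := by
    apply frobenius_inj (RFbar F) p
    rw [map_one, frobenius_def, ← pow_mul, mul_comm, ← hm]
    exact pow_orderOf_eq_one _
  have h2 := Nat.le_of_dvd (by rcases m.eq_zero_or_pos with rfl | h <;> omega)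
    (orderOf_dvd_iff_pow_eq_one.mpr h1)
  have hp := (Fact.out : p.Prime).two_le
  rw [← orderMod] at h2
  nlinarith

/-- The absolute value of `x ^ k - 1` depends on `k` through its `p`-part only: write
`k = n p ^ e m` with `p ∤ m`; the exponent `m` changes `x ^ n - 1` by a unit, and raising to the
power `p ^ e` commutes with subtracting `1`. -/
theorem absBar_pow_sub_one_of_dvd (p : ℕ) [Fact p.Prime] [CharP F p] {x : RFbar F}
    (hx : absBar x = 1) {k : ℕ} (hk0 : k ≠ 0) (hk : orderMod x ∣ k) :
    absBar (x ^ k - 1) = absBar (x ^ orderMod x - 1) ^ p ^ padicValNat p k := by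
  have : CharP (RFbar F) p := charP_of_injective_ringHom (constEmb F).injective p
  have hpn := not_dvd_orderMod p hx
  have hy := absBar_pow_sub_one_lt hx dvd_rfl
  obtain ⟨l, rfl⟩ := hk
  set n := orderMod x
  set y := x ^ n with hydef
  have hl0 : l ≠ 0 := right_ne_zero_of_mul hk0
  have hval : padicValNat p (n * l) = padicValNat p l := by
    rw [padicValNat.mul (left_ne_zero_of_mul hk0) hl0, padicValNat.eq_zero_of_not_dvd hpn, zero_add]
  obtain ⟨m, hm⟩ : p ^ padicValNat p l ∣ l := pow_padicValNat_dvd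
  have hpm : ¬ p ∣ m := by
    rintro ⟨c, rfl⟩
    refine pow_succ_padicValNat_not_dvd (p := p) hl0 ⟨c, ?_⟩
    rw [pow_succ, mul_assoc]
    exact hm
  have hy1 : absBar y ≤ 1 := by rw [hydef, absBar_pow, hx, one_pow]
  have hm1 : absBar ((m : RFbar F)) = 1 := by
    refine absBar_eq_one_of_isIntegralElem ?_ ?_
    · rw [← map_natCast (constEmb F)]
      exact (constEmb F).isIntegralElem_map
    · rwa [Ne, CharP.cast_eq_zero_iff (RFbar F) p]
  have hgeom : absBar (∑ i ∈ Finset.range m, y ^ i) = 1 := by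
    have h1 : ∑ i ∈ Finset.range m, y ^ i =
        (m : RFbar F) - ∑ i ∈ Finset.range m, (1 - y ^ i) := by
      rw [Finset.sum_sub_distrib]
      simp
    rw [h1, absBar_sub_eq_of_lt, hm1]
    rw [hm1]
    refine absBar_sum_lt _ _ one_pos fun i _ => ?_
    rw [absBar_sub_comm]
    have := absBar_pow_sub_pow_lt hy1 absBar_one.le hy i
    rwa [one_pow] at this
  rw [hval, pow_mul]
  conv_lhs => rw [hm, mul_comm, pow_mul]
  have hfrob := sub_pow_char_pow (y ^ m) (1 : RFbar F) (p := p) (n := padicValNat p l)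
  rw [one_pow] at hfrob
  rw [← hfrob, absBar_pow, ← geom_sum_mul, absBar_mul, hgeom, one_mul]

theorem orderMod_eq_orderOf {x : RFbar F} (hx : IsOfFinOrder x) : orderMod x = orderOf x := by
  rw [orderMod, constantTerm_eq ⟨Or.inr hx, by rw [sub_self, absBar_zero]; exact one_pos⟩]

theorem absBar_pow_sub_one_of_isOfFinOrder {x : RFbar F} (hx : IsOfFinOrder x) (k : ℕ) :
    absBar (x ^ k - 1) = if orderMod x ∣ k then 0 else 1 := by
  split_ifs with h
  · rw [orderMod_eq_orderOf hx] at h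
    rw [orderOf_dvd_iff_pow_eq_one.mp h, sub_self, absBar_zero]
  · exact absBar_pow_sub_one_of_not_dvd (absBar_eq_one_of_isOfFinOrder hx) h

theorem absBar_pow_sub_one_of_ne_one {x : RFbar F} (hx : absBar x ≠ 1) {k : ℕ} (hk : k ≠ 0) :
    absBar (x ^ k - 1) = max 1 (absBar x) ^ k := by
  rcases lt_or_gt_of_ne hx with h | h
  · rw [max_eq_left h.le, one_pow, absBar_sub_comm, absBar_sub_eq_of_lt, absBar_one]
    rw [absBar_one, absBar_pow]
    exact pow_lt_one₀ (absBar_nonneg x) h hk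
  · rw [max_eq_right h.le, absBar_sub_eq_of_lt, absBar_pow]
    rw [absBar_one, absBar_pow]
    exact one_lt_pow₀ h hk

open scoped Classical in
/-- The product formula for `|det (A ^ k - 1)|`: the eigenvalues of absolute value different from
`1` contribute `r(A) ^ k`, the roots of unity an indicator, and the other eigenvalues of absolute
value `1` a factor depending on the `p`-part of `k`. -/
theorem norm_det_pow_sub_one (p : ℕ) [Fact p.Prime] [CharP F p] {d : ℕ}
    (A : Matrix (Fin d) (Fin d) F[X]) {M N : ℕ} {μ : Fin M → RFbar F} {η : Fin N → RFbar F}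
    (hμ : Finset.univ.val.map μ = (eigenvaluesBar A).filter fun l => IsOfFinOrder l)
    (hη : Finset.univ.val.map η =
      (eigenvaluesBar A).filter fun l => absBar l = 1 ∧ ¬ IsOfFinOrder l)
    {k : ℕ} (hk : k ≠ 0) :
    ‖polyToRF F (A ^ k - 1).det‖ = rOf A ^ k * ((∏ i, if orderMod (μ i) ∣ k then 0 else 1) *
      ∏ j, if orderMod (η j) ∣ k then
        absBar (η j ^ orderMod (η j) - 1) ^ p ^ padicValNat p k else 1) := by
  have hη1 : ∀ j, absBar (η j) = 1 := fun j => by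
    have : η j ∈ Finset.univ.val.map η := Multiset.mem_map_of_mem η (Finset.mem_univ j)
    rw [hη] at this
    exact (Multiset.mem_filter.mp this).2.1
  have hμ1 : ∀ i, IsOfFinOrder (μ i) := fun i => by
    have : μ i ∈ Finset.univ.val.map μ := Multiset.mem_map_of_mem μ (Finset.mem_univ i)
    rw [hμ] at this
    exact (Multiset.mem_filter.mp this).2
  have h1 : ‖polyToRF F (A ^ k - 1).det‖ =
      ((eigenvaluesBar A).map fun l => absBar (l ^ k - 1)).prod := by
    rw [← absBar_algebraMap, ← RingHom.comp_apply, RingHom.map_det, map_sub, map_pow, map_one,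
      RingHom.mapMatrix_apply, det_pow_sub_one _ hk, absBar_multiset_prod, Multiset.map_map]
    rfl
  have h2 : ∀ l : RFbar F, absBar (l ^ k - 1) = max 1 (absBar l) ^ k *
      ((if IsOfFinOrder l then absBar (l ^ k - 1) else 1) *
        (if absBar l = 1 ∧ ¬ IsOfFinOrder l then absBar (l ^ k - 1) else 1)) := by
    intro l
    by_cases hf : IsOfFinOrder l
    · simp [hf, absBar_eq_one_of_isOfFinOrder hf]
    · by_cases h1 : absBar l = 1
      · simp [hf, h1]
      · simp only [hf, h1, if_false, false_and, mul_one]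
        exact absBar_pow_sub_one_of_ne_one h1 hk
  rw [h1, Multiset.map_congr rfl fun l _ => h2 l, Multiset.prod_map_mul, Multiset.prod_map_mul,
    Multiset.prod_map_pow, ← prod_map_filter_eq_ite, ← prod_map_filter_eq_ite, ← hμ, ← hη,
    Multiset.map_map, Multiset.map_map, rOf]
  congr 2
  · exact Finset.prod_congr rfl fun i _ => absBar_pow_sub_one_of_isOfFinOrder (hμ1 i) k
  · refine Finset.prod_congr rfl fun j _ => ?_
    split_ifs with h
    · exact absBar_pow_sub_one_of_dvd p (hη1 j) hk h
    · exact absBar_pow_sub_one_of_not_dvd (hη1 j) h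

theorem one_le_rOf {d : ℕ} (A : Matrix (Fin d) (Fin d) F[X]) : 1 ≤ rOf A := by
  refine one_le_multiset_prod fun x hx => ?_
  obtain ⟨l, -, rfl⟩ := Multiset.mem_map.mp hx
  exact le_max_left _ _

end UnitNorm

/-! ### Logarithmic derivatives of power series and binomial series -/

section LogDerivative

open PowerSeries

theorem constantCoeff_subst_of_constantCoeff_zero {f g : PowerSeries ℂ}
    (hg : constantCoeff g = 0) : constantCoeff (f.subst g) = constantCoeff f := by
  have hs : HasSubst g := HasSubst.of_constantCoeff_zero' hg
  have h := constantCoeff_subst_eq_zero (R := ℂ) (a := g) hg (f - C (constantCoeff f)) (by simp)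
  rw [← coe_substAlgHom hs, map_sub, map_sub, coe_substAlgHom] at h
  rw [show subst g (C (constantCoeff f)) = C (constantCoeff f) from subst_C _] at h
  exact (sub_eq_zero.mp h).trans (constantCoeff_C _)

/-- `f` has constant coefficient `1` and logarithmic derivative `G / X`; these two conditions
determine `f`. The factor `X` keeps `G` a power series with the exponents of `∑ N_k X ^ k`. -/
structure HasLogDeriv (f G : PowerSeries ℂ) : Prop where
  constantCoeff : PowerSeries.constantCoeff f = 1
  deriv : X * d⁄dX ℂ f = G * f

namespace HasLogDeriv

theorem unique {f g G : PowerSeries ℂ} (hf : HasLogDeriv f G) (hg : HasLogDeriv g G) : f = g := by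
  have hg0 : PowerSeries.constantCoeff g ≠ 0 := by rw [hg.constantCoeff]; exact one_ne_zero
  have hinv : g * g⁻¹ = 1 := PowerSeries.mul_inv_cancel g hg0
  have hder : X * d⁄dX ℂ (f * g⁻¹) = 0 := by
    rw [Derivation.leibniz, derivative_inv', smul_eq_mul, smul_eq_mul]
    linear_combination g⁻¹ * hf.deriv - f * g⁻¹ ^ 2 * hg.deriv - f * G * g⁻¹ * hinv
  have h1 : f * g⁻¹ = 1 := by
    refine PowerSeries.derivative.ext ?_ ?_
    · rw [(mul_eq_zero.mp hder).resolve_left X_ne_zero, derivative_one]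
    · rw [map_mul, constantCoeff_inv, hf.constantCoeff, hg.constantCoeff]
      simp
  calc f = f * g⁻¹ * g := by rw [mul_assoc, mul_comm g⁻¹, hinv, mul_one]
    _ = g := by rw [h1, one_mul]

theorem one : HasLogDeriv 1 0 := ⟨by simp, by simp⟩

theorem mul {f g G H : PowerSeries ℂ} (hf : HasLogDeriv f G) (hg : HasLogDeriv g H) :
    HasLogDeriv (f * g) (G + H) where
  constantCoeff := by rw [map_mul, hf.constantCoeff, hg.constantCoeff, one_mul]
  deriv := by
    rw [Derivation.leibniz, smul_eq_mul, smul_eq_mul]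
    linear_combination g * hf.deriv + f * hg.deriv

theorem prod {ι : Type*} (s : Finset ι) {f G : ι → PowerSeries ℂ}
    (h : ∀ i ∈ s, HasLogDeriv (f i) (G i)) : HasLogDeriv (∏ i ∈ s, f i) (∑ i ∈ s, G i) := by
  classical
  induction s using Finset.induction_on with
  | empty => simpa using one
  | insert i s hi ih =>
    rw [Finset.prod_insert hi, Finset.sum_insert hi]
    exact (h i (Finset.mem_insert_self i s)).mul
      (ih fun j hj => h j (Finset.mem_insert_of_mem hj))

theorem exp {g : PowerSeries ℂ} (hg : PowerSeries.constantCoeff g = 0) :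
    HasLogDeriv ((PowerSeries.exp ℂ).subst g) (X * d⁄dX ℂ g) where
  constantCoeff := by
    rw [constantCoeff_subst_of_constantCoeff_zero hg, constantCoeff_exp]
  deriv := by
    rw [derivative_subst (HasSubst.of_constantCoeff_zero' hg), derivative_exp]
    ring

end HasLogDeriv

/-- The zeta function is determined by the series `∑ N_k X ^ k`, its logarithmic derivative times
`X`. -/
theorem hasLogDeriv_artinMazurZeta {Y : Type*} [TopologicalSpace Y] (f : Y → Y) :
    HasLogDeriv (artinMazurZeta f) (fixedPointSeries f) := by
  have h := HasLogDeriv.exp (g := PowerSeries.mk fun k =>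
    if k = 0 then 0 else (numIsolated f k : ℂ) / (k : ℂ)) (by simp)
  suffices hG : fixedPointSeries f = X * d⁄dX ℂ (PowerSeries.mk fun k =>
      if k = 0 then 0 else (numIsolated f k : ℂ) / (k : ℂ)) by
    rw [hG]
    exact h
  ext n
  cases n with
  | zero => simp [fixedPointSeries]
  | succ n =>
    have : (n : ℂ) + 1 ≠ 0 := by exact_mod_cast n.succ_ne_zero
    rw [coeff_succ_X_mul, coeff_derivative]
    simp [fixedPointSeries]
    field_simp

theorem succ_mul_choose_succ (a : ℚ) (n : ℕ) :
    ((n : ℚ) + 1) * Ring.choose a (n + 1) = (a - n) * Ring.choose a n := by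
  have h1 := Ring.descPochhammer_eq_factorial_smul_choose a n
  have h2 := Ring.descPochhammer_eq_factorial_smul_choose a (n + 1)
  rw [descPochhammer_succ_right, Polynomial.smeval_mul, h1] at h2
  simp only [Polynomial.smeval_sub, Polynomial.smeval_X, Polynomial.smeval_natCast, pow_one,
    pow_zero, nsmul_eq_mul, mul_one, Nat.factorial_succ, Nat.cast_mul, Nat.cast_succ] at h2
  have hn : ((n.factorial : ℕ) : ℚ) ≠ 0 := by exact_mod_cast n.factorial_ne_zero
  apply mul_left_cancel₀ hn
  linear_combination -h2

theorem one_add_X_mul_derivative_binomialSeries (a : ℚ) :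
    (1 + X) * d⁄dX ℂ (PowerSeries.binomialSeries ℂ a) = C (a : ℂ) * PowerSeries.binomialSeries ℂ a := by
  ext n
  have key : ∀ n : ℕ, ((n : ℂ) + 1) * ((Ring.choose a (n + 1) : ℚ) : ℂ) =
      ((a : ℂ) - n) * ((Ring.choose a n : ℚ) : ℂ) := fun n => by
    exact_mod_cast congrArg (Rat.cast : ℚ → ℂ) (succ_mul_choose_succ a n)
  rw [add_mul, one_mul, map_add, coeff_C_mul, coeff_derivative]
  cases n with
  | zero =>
    have := key 0
    simp only [coeff_zero_X_mul, binomialSeries_coeff, Rat.smul_one_eq_cast]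
    push_cast at this ⊢
    linear_combination this
  | succ n =>
    have := key (n + 1)
    simp only [coeff_succ_X_mul, coeff_derivative, binomialSeries_coeff, Rat.smul_one_eq_cast]
    push_cast at this ⊢
    linear_combination this

/-- The series `∑ (r X) ^ k`, over the positive multiples `k` of `L`. -/
noncomputable def multiplesSeries (r : ℝ) (L : ℕ) : PowerSeries ℂ :=
  PowerSeries.mk fun k => if k ≠ 0 ∧ L ∣ k then (r : ℂ) ^ k else 0

theorem constantCoeff_neg_C_mul_X_pow (r : ℝ) {L : ℕ} (hL : L ≠ 0) :
    constantCoeff (-(C (r : ℂ) * X) ^ L : PowerSeries ℂ) = 0 := by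
  simp [hL]

theorem one_sub_mul_multiplesSeries (r : ℝ) {L : ℕ} (hL : L ≠ 0) :
    (1 - (C (r : ℂ) * X) ^ L) * multiplesSeries r L = (C (r : ℂ) * X) ^ L := by
  ext n
  rw [sub_mul, one_mul, mul_pow, ← map_pow, map_sub, mul_assoc, coeff_C_mul, coeff_C_mul,
    coeff_X_pow_mul', coeff_X_pow]
  simp only [multiplesSeries, coeff_mk]
  rcases lt_trichotomy n L with h | h | h
  · have h1 : ¬ (n ≠ 0 ∧ L ∣ n) := fun hh => absurd (Nat.le_of_dvd (by omega) hh.2) (by omega)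
    simp [h1, h.ne, not_le.mpr h]
  · subst h
    simp [hL]
  · have h1 : (n ≠ 0 ∧ L ∣ n) ↔ (n - L ≠ 0 ∧ L ∣ n - L) := by
      rw [Nat.dvd_sub_iff_left h.le dvd_rfl]
      constructor <;> rintro ⟨-, h2⟩ <;> exact ⟨by omega, h2⟩
    by_cases h2 : n - L ≠ 0 ∧ L ∣ n - L
    · rw [if_pos (h1.mpr h2), if_pos h.le, if_pos h2, if_neg h.ne', ← pow_add,
        Nat.add_sub_cancel' h.le]
      simp
    · rw [if_neg (fun h3 => h2 (h1.mp h3)), if_pos h.le, if_neg h2, if_neg h.ne']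
      simp

theorem oneSubPow_add (r : ℝ) {L : ℕ} (hL : L ≠ 0) (a b : ℚ) :
    oneSubPow r L (a + b) = oneSubPow r L a * oneSubPow r L b := by
  rw [oneSubPow, binomialSeries_add,
    subst_mul (HasSubst.of_constantCoeff_zero' (constantCoeff_neg_C_mul_X_pow r hL))]
  rfl

theorem oneSubPow_zero (r : ℝ) {L : ℕ} (hL : L ≠ 0) : oneSubPow r L 0 = 1 := by
  have hs := HasSubst.of_constantCoeff_zero' (constantCoeff_neg_C_mul_X_pow r hL)
  rw [oneSubPow, binomialSeries_zero, ← coe_substAlgHom hs, map_one]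

theorem oneSubPow_one (r : ℝ) {L : ℕ} (hL : L ≠ 0) :
    oneSubPow r L 1 = 1 - (C (r : ℂ) * X) ^ L := by
  have hs := HasSubst.of_constantCoeff_zero' (constantCoeff_neg_C_mul_X_pow r hL)
  have h := binomialSeries_nat (R := ℚ) (A := ℂ) 1
  rw [Nat.cast_one, pow_one] at h
  rw [oneSubPow, h, ← coe_substAlgHom hs, map_add, map_one, coe_substAlgHom, subst_X hs]
  ring

theorem oneSubPow_natCast_mul (r : ℝ) {L : ℕ} (hL : L ≠ 0) (a : ℚ) (n : ℕ) :
    oneSubPow r L (n * a) = oneSubPow r L a ^ n := by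
  induction n with
  | zero => rw [Nat.cast_zero, zero_mul, oneSubPow_zero r hL, pow_zero]
  | succ n ih => rw [Nat.cast_succ, add_mul, one_mul, oneSubPow_add r hL, ih, pow_succ]

/-- With `g = -(r X) ^ L` both sides, multiplied by `1 + g`, equal `a L g` times the series. -/
theorem hasLogDeriv_oneSubPow (r : ℝ) {L : ℕ} (hL : L ≠ 0) (a : ℚ) :
    HasLogDeriv (oneSubPow r L a) (C (-((a : ℂ) * L)) * multiplesSeries r L) where
  constantCoeff := by
    rw [oneSubPow, constantCoeff_subst_of_constantCoeff_zero (constantCoeff_neg_C_mul_X_pow r hL),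
      binomialSeries_constantCoeff]
  deriv := by
    have hs := HasSubst.of_constantCoeff_zero' (constantCoeff_neg_C_mul_X_pow r hL)
    set g : PowerSeries ℂ := -(C (r : ℂ) * X) ^ L with hg
    have hXg : X * d⁄dX ℂ g = C (L : ℂ) * g := by
      obtain ⟨m, rfl⟩ := Nat.exists_eq_succ_of_ne_zero hL
      rw [hg, map_neg, derivative_pow, Derivation.leibniz, derivative_C, derivative_X]
      simp only [Nat.succ_sub_one, smul_eq_mul, mul_one, map_natCast,
        Nat.succ_eq_add_one]
      ring
    have hbin := congrArg (substAlgHom hs) (one_add_X_mul_derivative_binomialSeries a)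
    rw [map_mul, map_mul, map_add, map_one, coe_substAlgHom, subst_X hs,
      show subst g (C (a : ℂ)) = C (a : ℂ) from subst_C _] at hbin
    have hH : (1 + g) * multiplesSeries r L = -g := by
      linear_combination one_sub_mul_multiplesSeries r hL
    have h1 : (1 + g : PowerSeries ℂ) ≠ 0 := by
      intro h0
      have := congrArg PowerSeries.constantCoeff h0
      rw [map_add, hg, constantCoeff_neg_C_mul_X_pow r hL] at this
      simp at this
    apply mul_left_cancel₀ h1
    rw [oneSubPow, ← hg, derivative_subst hs,
      show (C (-((a : ℂ) * L)) : PowerSeries ℂ) = -(C (a : ℂ) * C (L : ℂ)) by rw [map_neg, map_mul]]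
    linear_combination (X * d⁄dX ℂ g) * hbin + C (a : ℂ) * (PowerSeries.binomialSeries ℂ a).subst g * hXg
      + C (a : ℂ) * C (L : ℂ) * (PowerSeries.binomialSeries ℂ a).subst g * hH

theorem inv_one_sub_eq_oneSubPow (r : ℝ) :
    (1 - C (r : ℂ) * X : PowerSeries ℂ)⁻¹ = oneSubPow r 1 (-1) := by
  have h : oneSubPow r 1 (-1) * (1 - C (r : ℂ) * X) = 1 := by
    rw [← pow_one (C (r : ℂ) * X), ← oneSubPow_one r one_ne_zero, ← oneSubPow_add r one_ne_zero,
      neg_add_cancel, oneSubPow_zero r one_ne_zero]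
  rw [eq_comm, PowerSeries.eq_inv_iff_mul_eq_one (by simp), h]

/-- Inclusion-exclusion over the sets of indices `i` with `m i ∣ k`. -/
theorem prod_ite_dvd_eq_sum_powerset {M : ℕ} (m : Fin M → ℕ) (k : ℕ) :
    (∏ i, if m i ∣ k then (0 : ℂ) else 1) =
      ∑ S : Finset (Fin M), (-1) ^ S.card * if S.lcm m ∣ k then 1 else 0 := by
  have h1 : ∀ i, (if m i ∣ k then (0 : ℂ) else 1) = 1 + -(if m i ∣ k then (1 : ℂ) else 0) := by
    intro i
    split_ifs <;> simp
  rw [Finset.prod_congr rfl fun i _ => h1 i, Finset.prod_one_add, Finset.powerset_univ]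
  refine Finset.sum_congr rfl fun S _ => ?_
  rw [Finset.prod_neg, Finset.prod_ite_zero]
  simp [Finset.lcm_dvd_iff]

theorem prod_eq_mul_prod_powersetCard {M : ℕ} {α : Type*} [CommMonoid α]
    (f : Finset (Fin M) → α) :
    ∏ S, f S = f ∅ * ∏ l ∈ Finset.Icc 1 M, ∏ S ∈ Finset.powersetCard l Finset.univ, f S := by
  rw [← Finset.powerset_univ, Finset.prod_powerset, Finset.card_univ, Fintype.card_fin,
    Finset.range_eq_Ico, Finset.prod_eq_prod_Ico_succ_bot (Nat.succ_pos M)]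
  simp
  rfl

/-- If the number of isolated fixed points of the `k`-th iterate is `r ^ k`, or zero when `k` is
divisible by some `m i`, then the zeta function is a product of binomial series. -/
theorem artinMazurZeta_eq_prod {Y : Type*} [TopologicalSpace Y] (f : Y → Y) (r : ℝ) {M : ℕ}
    (m : Fin M → ℕ) (hm : ∀ i, m i ≠ 0)
    (h : ∀ k, k ≠ 0 → (numIsolated f k : ℝ) = r ^ k * ∏ i, if m i ∣ k then 0 else 1) :
    artinMazurZeta f = ∏ S : Finset (Fin M),
      oneSubPow r (S.lcm m) ((-1) ^ (S.card + 1) / ((S.lcm m : ℕ) : ℚ)) := by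
  have hlcm : ∀ S : Finset (Fin M), S.lcm m ≠ 0 := fun S h0 => by
    obtain ⟨i, -, hi⟩ := Finset.lcm_eq_zero_iff.mp h0
    exact hm i hi
  refine (hasLogDeriv_artinMazurZeta f).unique ?_
  convert HasLogDeriv.prod Finset.univ fun S _ => hasLogDeriv_oneSubPow r (hlcm S)
    ((-1) ^ (S.card + 1) / ((S.lcm m : ℕ) : ℚ)) using 1
  ext k
  rw [map_sum]
  have hS : ∀ S : Finset (Fin M),
      -((((-1) ^ (S.card + 1) / ((S.lcm m : ℕ) : ℚ) : ℚ) : ℂ) * (S.lcm m : ℕ)) =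
        (-1) ^ S.card := by
    intro S
    have : ((S.lcm m : ℕ) : ℂ) ≠ 0 := by exact_mod_cast hlcm S
    push_cast
    field_simp
    ring
  simp only [hS, coeff_C_mul, fixedPointSeries, multiplesSeries, coeff_mk]
  by_cases hk : k = 0
  · simp [hk]
  · have h1 : (numIsolated f k : ℂ) = (r : ℂ) ^ k * ∏ i, if m i ∣ k then 0 else 1 := by
      have := congrArg (Complex.ofReal) (h k hk)
      push_cast at this
      rw [this]
      congr 1
      refine Finset.prod_congr rfl fun i _ => ?_
      split_ifs <;> simp
    rw [if_neg hk, h1, prod_ite_dvd_eq_sum_powerset, Finset.mul_sum]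
    refine Finset.sum_congr rfl fun S _ => ?_
    by_cases hd : S.lcm m ∣ k <;> simp [hd, hk]
    ring

theorem isAlgebraic_oneSubPow_one (r : ℝ) {L : ℕ} (hL : L ≠ 0) :
    IsAlgebraic (RatFunc ℂ) (oneSubPow r L 1 : ℂ⸨X⸩) := by
  have h : oneSubPow r L 1 =
      ((1 - (Polynomial.C (r : ℂ) * Polynomial.X) ^ L : ℂ[X]) : PowerSeries ℂ) := by
    rw [oneSubPow_one r hL]
    simp
  rw [h, RatFunc.coe_coe]
  exact isAlgebraic_algebraMap _

/-- Some power of `(1 - (r X) ^ L) ^ a` is rational. -/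
theorem isAlgebraic_oneSubPow (r : ℝ) {L : ℕ} (hL : L ≠ 0) (a : ℚ) :
    IsAlgebraic (RatFunc ℂ) (oneSubPow r L a : ℂ⸨X⸩) := by
  refine IsAlgebraic.of_pow a.den_pos ?_
  rw [← map_pow, ← oneSubPow_natCast_mul r hL, mul_comm, Rat.mul_den_eq_num]
  have hnat : ∀ n : ℕ, IsAlgebraic (RatFunc ℂ) (oneSubPow r L (n : ℚ) : ℂ⸨X⸩) := by
    intro n
    rw [← mul_one (n : ℚ), oneSubPow_natCast_mul r hL, map_pow]
    exact (isAlgebraic_oneSubPow_one r hL).pow n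
  obtain ⟨n, hn | hn⟩ := a.num.eq_nat_or_neg
  · rw [hn, Int.cast_natCast]
    exact hnat n
  · have h1 : (oneSubPow r L (-(n : ℚ)) : ℂ⸨X⸩) = (oneSubPow r L (n : ℚ) : ℂ⸨X⸩)⁻¹ := by
      apply eq_inv_of_mul_eq_one_left
      rw [← map_mul, ← oneSubPow_add r hL, neg_add_cancel, oneSubPow_zero r hL, map_one]
    rw [hn, Int.cast_neg, Int.cast_natCast, h1]
    exact (hnat n).inv

end LogDerivative

/-! ### Recurrences for D-finite series -/

section DFinite

open Polynomial

/-- The falling factorials, as a sequence of polynomials with one in each degree. -/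
noncomputable def descPochhammerSequence : Polynomial.Sequence ℂ where
  elems' := descPochhammer ℂ
  degree_eq' i := by
    change (descPochhammer ℂ i).degree = i
    rw [degree_eq_natDegree (monic_descPochhammer ℂ i).ne_zero, descPochhammer_natDegree]

theorem linearIndependent_descPochhammer : LinearIndependent ℂ (descPochhammer ℂ) :=
  descPochhammerSequence.linearIndependent

theorem laurentSeries_coeff_iterate_derivative (f : ℂ⸨X⸩) (i : ℕ) (m : ℤ) :
    ((LaurentSeries.derivative ℂ)^[i] f).coeff m =
      (descPochhammer ℂ i).eval ((m : ℂ) + i) * f.coeff (m + i) := by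
  rw [LaurentSeries.derivative_iterate_coeff, ← aeval_eq_smeval, zsmul_eq_mul]
  congr 1
  have h := Polynomial.eval_intCast_map (Int.castRingHom ℂ) (descPochhammer ℤ i) (m + i)
  rw [descPochhammer_map, Int.cast_id] at h
  rw [coe_aeval_eq_eval, ← eq_intCast (Int.castRingHom ℂ), ← h]
  push_cast
  rfl

theorem coeff_polynomial_smul (q : ℂ[X]) (h : ℂ⸨X⸩) (m : ℤ) :
    (q • h).coeff m = ∑ j ∈ Finset.range (q.natDegree + 1), q.coeff j * h.coeff (m - j) := by
  have hmon : ∀ (j : ℕ) (c : ℂ), (monomial j c • h).coeff m = c * h.coeff (m - j) := by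
    intro j c
    have : algebraMap ℂ[X] ℂ⸨X⸩ (monomial j c) = HahnSeries.single (j : ℤ) c := by
      rw [HahnSeries.algebraMap_apply']
      rw [PowerSeries.algebraMap_apply', Algebra.algebraMap_self, PowerSeries.map_id,
        ← C_mul_X_pow_eq_monomial, id_eq, coe_mul, coe_pow, coe_C, coe_X, map_mul,
        HahnSeries.ofPowerSeries_C, HahnSeries.ofPowerSeries_X_pow, HahnSeries.C_apply,
        HahnSeries.single_mul_single, zero_add, mul_one]
    rw [Algebra.smul_def, this, HahnSeries.coeff_single_mul]
  conv_lhs => rw [Algebra.smul_def, q.as_sum_range, map_sum, Finset.sum_mul]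
  rw [HahnSeries.coeff_sum]
  refine Finset.sum_congr rfl fun j _ => ?_
  rw [← Algebra.smul_def, hmon]

/-- The coefficients of a D-finite series satisfy a nontrivial linear recurrence with polynomial
coefficients. The shifts `t` are integers, and the coefficient at the shift `t` is evaluated at the
shifted index. -/
theorem IsDFinite.exists_recurrence {f : ℂ⸨X⸩} (hf : IsDFinite f) :
    ∃ (T : Finset ℤ) (P : ℤ → ℂ[X]), (∃ t ∈ T, P t ≠ 0) ∧
      ∀ m : ℤ, ∑ t ∈ T, (P t).eval ((m + t : ℤ) : ℂ) * f.coeff (m + t) = 0 := by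
  classical
  have hdep : ¬ LinearIndependent ℂ[X] fun n : ℕ => (LaurentSeries.derivative ℂ)^[n] f := by
    rw [LinearIndependent.iff_fractionRing ℂ[X] (RatFunc ℂ)]
    intro hli
    have hfin : FiniteDimensional (RatFunc ℂ) (Submodule.span (RatFunc ℂ)
      (Set.range fun n : ℕ => (LaurentSeries.derivative ℂ)^[n] f)) := hf
    exact not_finite_iff_infinite.mpr (inferInstanceAs (Infinite ℕ))
      (linearIndependent_span hli).finite
  obtain ⟨s, c, hsum, i₀, hi₀, hc⟩ := not_linearIndependent_iff.mp hdep
  let U : Finset (ℕ × ℕ) := s.sigma (fun i => Finset.range ((c i).natDegree + 1)) |>.map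
    (Equiv.sigmaEquivProd ℕ ℕ).toEmbedding
  have hU : ∀ u : ℕ × ℕ, u ∈ U ↔ u.1 ∈ s ∧ u.2 < (c u.1).natDegree + 1 := by
    rintro ⟨i, j⟩
    simp [U]
  let δ : ℕ × ℕ → ℤ := fun u => (u.1 : ℤ) - u.2
  let P : ℤ → ℂ[X] := fun t => ∑ u ∈ U with δ u = t, (c u.1).coeff u.2 • descPochhammer ℂ u.1
  refine ⟨U.image δ, P, ?_, ?_⟩
  · let u₀ : ℕ × ℕ := (i₀, (c i₀).natDegree)
    have hu₀ : u₀ ∈ U := (hU u₀).mpr ⟨hi₀, Nat.lt_succ_self _⟩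
    refine ⟨δ u₀, Finset.mem_image_of_mem δ hu₀, fun h0 => hc ?_⟩
    -- for a fixed shift the pair is determined by its first component
    have hinj : Set.InjOn Prod.fst (({u ∈ U | δ u = δ u₀} : Finset (ℕ × ℕ)) : Set (ℕ × ℕ)) := by
      rintro ⟨i, j⟩ hu ⟨i', j'⟩ hu' h
      have h1 := (Finset.mem_filter.mp hu).2
      have h2 := (Finset.mem_filter.mp hu').2
      simp only [δ] at h h1 h2
      ext <;> simp <;> omega
    have hli := linearIndependent_descPochhammer.comp
      (fun u : {u // u ∈ ({u ∈ U | δ u = δ u₀} : Finset (ℕ × ℕ))} => u.1.1)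
      (fun u v h => Subtype.ext (hinj u.2 v.2 h))
    rw [Fintype.linearIndependent_iff] at hli
    have h1 := hli (fun u => (c u.1.1).coeff u.1.2) (by
      rw [← h0]
      exact Finset.sum_coe_sort ({u ∈ U | δ u = δ u₀} : Finset (ℕ × ℕ))
        fun u => (c u.1).coeff u.2 • descPochhammer ℂ u.1)
      ⟨u₀, Finset.mem_filter.mpr ⟨hu₀, rfl⟩⟩
    exact leadingCoeff_eq_zero.mp h1
  · intro m
    have h1 := congrArg (fun g : ℂ⸨X⸩ => g.coeff m) hsum
    simp only [HahnSeries.coeff_sum, HahnSeries.coeff_zero, coeff_polynomial_smul,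
      laurentSeries_coeff_iterate_derivative] at h1
    rw [Finset.sum_sigma'] at h1
    rw [← h1]
    have h2 : ∀ t ∈ U.image δ, (P t).eval ((m + t : ℤ) : ℂ) * f.coeff (m + t) =
        ∑ u ∈ U with δ u = t, (c u.1).coeff u.2 *
          ((descPochhammer ℂ u.1).eval ((m + δ u : ℤ) : ℂ) * f.coeff (m + δ u)) := by
      intro t _
      simp only [P, eval_finsetSum, Finset.sum_mul]
      refine Finset.sum_congr rfl fun u hu => ?_
      rw [(Finset.mem_filter.mp hu).2, eval_smul, smul_eq_mul, mul_assoc]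
    rw [Finset.sum_congr rfl h2,
      Finset.sum_fiberwise_of_maps_to fun u hu => Finset.mem_image_of_mem δ hu, Finset.sum_map]
    refine Finset.sum_congr rfl fun u _ => ?_
    simp only [δ, Equiv.coe_toEmbedding, Equiv.sigmaEquivProd_apply]
    rw [show m + ((u.1 : ℤ) - (u.2 : ℤ)) = m - u.2 + u.1 by ring]
    push_cast
    rfl

theorem padicValInt_eq_of_modEq {p : ℕ} [Fact p.Prime] {E : ℕ} {x y : ℤ}
    (hxy : (p : ℤ) ^ E ∣ x - y) (hx : ¬ (p : ℤ) ^ E ∣ x) : padicValInt p x = padicValInt p y := by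
  have hy : ¬ (p : ℤ) ^ E ∣ y := fun h => hx ((dvd_iff_dvd_of_dvd_sub hxy).mpr h)
  have hx0 : x ≠ 0 := fun h => hx (h ▸ dvd_zero _)
  have hy0 : y ≠ 0 := fun h => hy (h ▸ dvd_zero _)
  have key : ∀ m ≤ E, (m ≤ padicValInt p x ↔ m ≤ padicValInt p y) := by
    intro m hm
    have h1 := padicValInt_dvd_iff (p := p) m x
    have h2 := padicValInt_dvd_iff (p := p) m y
    have h3 := dvd_iff_dvd_of_dvd_sub ((pow_dvd_pow (p : ℤ) hm).trans hxy)
    tauto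
  have hxE : padicValInt p x < E := by
    by_contra! h
    exact hx ((padicValInt_dvd_iff E x).mpr (Or.inr h))
  have hyE : padicValInt p y < E := by
    by_contra! h
    exact hy ((padicValInt_dvd_iff E y).mpr (Or.inr h))
  exact le_antisymm ((key _ hxE.le).mp le_rfl) ((key _ hyE.le).mpr le_rfl)

/-- There are infinitely many positive integers with prescribed residue modulo `n` and prescribed
`p`-adic valuation. -/
theorem infinite_setOf_padicValInt_eq {p n : ℕ} [Fact p.Prime] (hn : n ≠ 0) (hpn : ¬ p ∣ n)
    (a : ℤ) (e : ℕ) (B : ℤ) :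
    {x : ℤ | B < x ∧ (n : ℤ) ∣ x - a ∧ padicValInt p x = e}.Infinite := by
  have hp : p.Prime := Fact.out
  have hco : IsCoprime ((p : ℤ) ^ (e + 1)) (n : ℤ) := by
    refine IsCoprime.pow_left ?_
    rw [Nat.isCoprime_iff_coprime]
    exact (Nat.Prime.coprime_iff_not_dvd hp).mpr hpn
  obtain ⟨u, v, huv⟩ := hco
  set q : ℤ := (p : ℤ) ^ (e + 1) with hq
  have hqpos : 0 < q := pow_pos (by exact_mod_cast hp.pos) _
  have hnpos : (0 : ℤ) < n := by exact_mod_cast Nat.pos_of_ne_zero hn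
  -- the solution of `x₁ ≡ p ^ e` modulo `p ^ (e + 1)` and `x₁ ≡ a` modulo `n`
  set x₁ : ℤ := p ^ e * (v * n) + a * (u * q) with hx₁
  set K : ℤ := |B| + |x₁| + 1 with hK
  refine Set.infinite_of_injective_forall_mem (f := fun y : ℕ => x₁ + (K + y) * (n * q)) ?_ ?_
  · intro y y' h
    have h1 : ((y : ℤ) - y') * (n * q) = 0 := by linear_combination h
    rcases mul_eq_zero.mp h1 with h2 | h2
    · omega
    · exact absurd h2 (mul_pos hnpos hqpos).ne'
  · intro y
    have hpx : (p : ℤ) ^ e ∣ x₁ + (K + y) * (n * q) := by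
      rw [hx₁, hq, pow_succ]
      exact ⟨v * n + a * (u * p) + (K + y) * (n * p), by ring⟩
    have hpx' : ¬ (p : ℤ) ^ (e + 1) ∣ x₁ + (K + y) * (n * q) := by
      intro h
      have h1 : (p : ℤ) ^ (e + 1) ∣ p ^ e := by
        have h2 : x₁ + (K + y) * (n * q) - p ^ e = q * (a * u - p ^ e * u + (K + y) * n) := by
          rw [hx₁]
          linear_combination (p : ℤ) ^ e * huv
        exact (dvd_iff_dvd_of_dvd_sub ⟨_, h2⟩).mp h
      have h3 : p ^ (e + 1) ∣ p ^ e := by exact_mod_cast h1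
      exact absurd ((Nat.pow_dvd_pow_iff_le_right hp.one_lt).mp h3) (by omega)
    refine ⟨?_, ?_, ?_⟩
    · have h1 : 1 ≤ n * q := mul_pos hnpos hqpos
      have h2 := neg_abs_le x₁
      have h3 := le_abs_self B
      have h4 := abs_nonneg B
      have h5 := abs_nonneg x₁
      have : (K + y) * 1 ≤ (K + y) * (n * q) := mul_le_mul_of_nonneg_left h1 (by omega)
      omega
    · exact ⟨p ^ e * v - a * v + (K + y) * q, by rw [hx₁]; linear_combination a * huv⟩
    · have h0 : x₁ + (K + y) * (n * q) ≠ 0 := fun h => hpx' (h ▸ dvd_zero _)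
      have h1 := ((padicValInt_dvd_iff _ _).mp hpx).resolve_left h0
      have h2 : ¬ e + 1 ≤ padicValInt p (x₁ + (K + y) * (n * q)) := fun h =>
        hpx' ((padicValInt_dvd_iff _ _).mpr (Or.inr h))
      omega

/-- A series with coefficients `r ^ k * c k ^ (p ^ v_p(k))`, with `c` periodic of period prime to
`p` and `0 < |c a| < 1` for some `a`, is not D-finite. In a recurrence single out a shift `t₀` and
let the shifted index `x` run over the integers `≡ a` modulo `n` which are highly divisible by `p`.
The coefficients at the other shifts then are constant up to the factor `r ^ x`, so that the
polynomial at `t₀`, multiplied by `c a ^ (p ^ e)`, does not depend on the valuation `e` of `x`. -/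
theorem not_isDFinite_of_coeff_eq {p n : ℕ} [Fact p.Prime] (hn : n ≠ 0) (hpn : ¬ p ∣ n) {r : ℂ}
    (hr : r ≠ 0) {c : ℤ → ℂ} (hc : ∀ x y : ℤ, (n : ℤ) ∣ x - y → c x = c y) {a : ℤ} (ha0 : c a ≠ 0)
    (ha1 : ‖c a‖ < 1) {f : ℂ⸨X⸩}
    (hf : ∀ x : ℤ, 0 < x → f.coeff x = r ^ x * c x ^ p ^ padicValInt p x) : ¬ IsDFinite f := by
  classical
  intro hfin
  have hp : p.Prime := Fact.out
  obtain ⟨T, P, ⟨t₀, ht₀, hP⟩, hrec⟩ := hfin.exists_recurrence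
  apply hP
  obtain ⟨E, hE⟩ : ∃ E : ℕ, ∀ t ∈ T, |t - t₀| < p ^ E := by
    refine ⟨∑ t ∈ T, (t - t₀).natAbs, fun t ht => ?_⟩
    have h1 : (t - t₀).natAbs ≤ ∑ t ∈ T, (t - t₀).natAbs :=
      Finset.single_le_sum (f := fun t => (t - t₀).natAbs) (fun _ _ => Nat.zero_le _) ht
    have h2 := Nat.lt_pow_self (n := ∑ t ∈ T, (t - t₀).natAbs) hp.one_lt
    rw [Int.abs_eq_natAbs]
    exact_mod_cast h1.trans_lt h2
  let κ : ℤ → ℂ := fun u => r ^ u * c (a + u) ^ p ^ padicValInt p u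
  let Q : ℂ[X] := ∑ t ∈ T.erase t₀, C (κ (t - t₀)) * (P t).comp (X + C ((t - t₀ : ℤ) : ℂ))
  have hpoly : ∀ e, E ≤ e → Q + C (c a ^ p ^ e) * P t₀ = 0 := by
    intro e he
    refine eq_zero_of_infinite_isRoot _ (((infinite_setOf_padicValInt_eq hn hpn a e
      (p ^ E)).image (f := fun x : ℤ => (x : ℂ)) (Int.cast_injective.injOn)).mono ?_)
    rintro _ ⟨x, ⟨hxB, hxa, hxe⟩, rfl⟩
    have hpE : (0 : ℤ) < p ^ E := pow_pos (by exact_mod_cast hp.pos) _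
    have hxE : (p : ℤ) ^ E ∣ x := (padicValInt_dvd_iff E x).mpr (Or.inr (hxe ▸ he))
    have hcoeff : ∀ t ∈ T.erase t₀, f.coeff (x + (t - t₀)) = r ^ x * κ (t - t₀) := by
      intro t ht
      have h1 := abs_lt.mp (hE t (Finset.mem_of_mem_erase ht))
      have h2 : t - t₀ ≠ 0 := sub_ne_zero.mpr (Finset.ne_of_mem_erase ht)
      rw [hf _ (by omega), zpow_add₀ hr, mul_assoc]
      congr 2
      rw [hc (x + (t - t₀)) (a + (t - t₀)) (by simpa using hxa)]
      congr 2
      refine (padicValInt_eq_of_modEq (E := E) ?_ ?_).symm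
      · simpa using hxE
      · intro h
        have h3 := Int.le_of_dvd (abs_pos.mpr h2) ((dvd_abs _ _).mpr h)
        exact absurd (hE t (Finset.mem_of_mem_erase ht)) (not_lt.mpr h3)
    have h0 : f.coeff x = r ^ x * c a ^ p ^ e := by
      rw [hf x (by omega), hxe, hc x a hxa]
    have h1 := hrec (x - t₀)
    rw [← Finset.add_sum_erase _ _ ht₀, sub_add_cancel, h0] at h1
    have h2 : ∀ t ∈ T.erase t₀, (P t).eval ((x - t₀ + t : ℤ) : ℂ) * f.coeff (x - t₀ + t) =
        r ^ x * (C (κ (t - t₀)) * (P t).comp (X + C ((t - t₀ : ℤ) : ℂ))).eval (x : ℂ) := by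
      intro t ht
      rw [show x - t₀ + t = x + (t - t₀) by ring, hcoeff t ht, eval_mul, eval_C, eval_comp,
        eval_add, eval_X, eval_C, Int.cast_add]
      ring
    rw [Finset.sum_congr rfl h2, ← Finset.mul_sum] at h1
    rw [Set.mem_ofPred_eq, IsRoot.def, eval_add, eval_finsetSum, eval_mul, eval_C]
    have hrx : r ^ x ≠ 0 := zpow_ne_zero _ hr
    apply (mul_eq_zero.mp (?_ : r ^ x * _ = 0)).resolve_left hrx
    linear_combination h1
  have h1 : C (c a ^ p ^ E - c a ^ p ^ (E + 1)) * P t₀ = 0 := by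
    rw [C_sub]
    linear_combination hpoly E le_rfl - hpoly (E + 1) (Nat.le_succ E)
  refine (mul_eq_zero.mp h1).resolve_left ?_
  rw [C_eq_zero, sub_eq_zero]
  intro h
  have h2 := congrArg norm h
  rw [norm_pow, norm_pow] at h2
  exact absurd h2 (pow_lt_pow_right_of_lt_one₀ (norm_pos_iff.mpr ha0) ha1
    (Nat.pow_lt_pow_right hp.one_lt (Nat.lt_succ_self E))).ne'

end DFinite

/-! ### Algebraic series and D-finiteness -/

section AlgebraicDFinite

theorem laurentSeries_coeff_derivative (f : ℂ⸨X⸩) (m : ℤ) :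
    (LaurentSeries.derivative ℂ f).coeff m = ((m : ℂ) + 1) * f.coeff (m + 1) := by
  simp

/-- The Leibniz rule, checked on the coefficients of `X * f'`, which are supported in the support
of `f`. -/
theorem laurentSeries_derivative_mul (f g : ℂ⸨X⸩) :
    LaurentSeries.derivative ℂ (f * g) =
      f * LaurentSeries.derivative ℂ g + g * LaurentSeries.derivative ℂ f := by
  let X' : ℂ⸨X⸩ := HahnSeries.single 1 1
  have hcoeff : ∀ (h : ℂ⸨X⸩) (m : ℤ),
      (X' * LaurentSeries.derivative ℂ h).coeff m = m * h.coeff m := by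
    intro h m
    rw [HahnSeries.coeff_single_mul, one_mul, laurentSeries_coeff_derivative, sub_add_cancel]
    push_cast
    ring
  have hsupp : ∀ h : ℂ⸨X⸩, (X' * LaurentSeries.derivative ℂ h).support ⊆ h.support := by
    intro h m hm hm0
    exact hm (by rw [hcoeff, hm0, mul_zero])
  have hX : X' ≠ 0 := HahnSeries.single_ne_zero one_ne_zero
  apply mul_left_cancel₀ hX
  rw [mul_add, mul_left_comm, ← mul_assoc X' g, mul_comm X' g, mul_assoc g,
    mul_comm g]
  ext m
  rw [hcoeff, HahnSeries.coeff_add, HahnSeries.coeff_mul,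
    HahnSeries.coeff_mul_right' g.isPWO_support (hsupp g),
    HahnSeries.coeff_mul_left' f.isPWO_support (hsupp f), Finset.mul_sum, ← Finset.sum_add_distrib]
  refine Finset.sum_congr rfl fun u hu => ?_
  rw [hcoeff, hcoeff]
  have h1 : ((u.1 : ℂ) + u.2) = m := by
    exact_mod_cast congrArg (Int.cast : ℤ → ℂ) (Finset.mem_antidiagonal.mp hu).2.2
  rw [← h1]
  ring

/-- Differentiation of Laurent series, as a derivation; the `ℂ`-algebra structure is the
coefficientwise one. -/
noncomputable def laurentDerivation :
    @Derivation ℂ ℂ⸨X⸩ ℂ⸨X⸩ _ _ _ HahnSeries.instAlgebra _ _ :=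
  @Derivation.mk' ℂ _ ℂ⸨X⸩ _ HahnSeries.instAlgebra ℂ⸨X⸩ _ _ _
    (LaurentSeries.derivative ℂ : ℂ⸨X⸩ →ₗ[ℂ] ℂ⸨X⸩) laurentSeries_derivative_mul

theorem laurentDerivation_apply (f : ℂ⸨X⸩) :
    laurentDerivation f = LaurentSeries.derivative ℂ f := rfl

theorem laurentDerivation_mul (f g : ℂ⸨X⸩) :
    laurentDerivation (f * g) = f * laurentDerivation g + g * laurentDerivation f :=
  laurentSeries_derivative_mul f g

theorem laurentDerivation_pow (f : ℂ⸨X⸩) (n : ℕ) :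
    laurentDerivation (f ^ n) = n * f ^ (n - 1) * laurentDerivation f := by
  let : Algebra ℂ ℂ⸨X⸩ := HahnSeries.instAlgebra
  rw [Derivation.leibniz_pow laurentDerivation, smul_eq_mul, nsmul_eq_mul, mul_assoc]

theorem laurentDerivation_div (f g : ℂ⸨X⸩) : laurentDerivation (f / g) =
    g⁻¹ ^ 2 * (g * laurentDerivation f - f * laurentDerivation g) := by
  let : Algebra ℂ ℂ⸨X⸩ := HahnSeries.instAlgebra
  rw [Derivation.leibniz_div laurentDerivation, smul_eq_mul, smul_eq_mul, smul_eq_mul]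

theorem laurentDerivation_coe (f : PowerSeries ℂ) :
    laurentDerivation (f : ℂ⸨X⸩) = (PowerSeries.derivative ℂ f : PowerSeries ℂ) := by
  ext m
  rw [laurentDerivation_apply, laurentSeries_coeff_derivative, PowerSeries.coeff_coe,
    PowerSeries.coeff_coe]
  rcases lt_trichotomy m (-1) with h | rfl | h
  · rw [if_pos (by omega), if_pos (by omega), mul_zero]
  · simp
  · obtain ⟨n, rfl⟩ := Int.eq_ofNat_of_zero_le (show 0 ≤ m by omega)
    rw [if_neg (by omega), if_neg (by omega), PowerSeries.coeff_derivative]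
    rw [show ((n : ℤ) + 1).natAbs = n + 1 by omega, Int.natAbs_natCast, mul_comm]
    push_cast
    rfl

theorem laurentDerivation_algebraMap (c : RatFunc ℂ) :
    ∃ c' : RatFunc ℂ, laurentDerivation (algebraMap (RatFunc ℂ) ℂ⸨X⸩ c) =
      algebraMap (RatFunc ℂ) ℂ⸨X⸩ c' := by
  have hpoly : ∀ q : ℂ[X],
      laurentDerivation (algebraMap (RatFunc ℂ) ℂ⸨X⸩ (algebraMap ℂ[X] (RatFunc ℂ) q)) =
      algebraMap (RatFunc ℂ) ℂ⸨X⸩ (algebraMap ℂ[X] (RatFunc ℂ) (Polynomial.derivative q)) := by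
    intro q
    change laurentDerivation (algebraMap (RatFunc ℂ) ℂ⸨X⸩ (q : RatFunc ℂ)) =
      algebraMap (RatFunc ℂ) ℂ⸨X⸩ (Polynomial.derivative q : ℂ[X])
    rw [← RatFunc.coe_coe, ← RatFunc.coe_coe, laurentDerivation_coe, PowerSeries.derivative_coe]
  obtain ⟨u, v, -, rfl⟩ := IsFractionRing.div_surjective (A := ℂ[X]) c
  have hu := hpoly u
  have hv := hpoly v
  refine ⟨((algebraMap ℂ[X] (RatFunc ℂ) v)⁻¹) ^ 2 * (algebraMap ℂ[X] (RatFunc ℂ) v *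
    algebraMap ℂ[X] (RatFunc ℂ) (Polynomial.derivative u) -
    algebraMap ℂ[X] (RatFunc ℂ) u * algebraMap ℂ[X] (RatFunc ℂ) (Polynomial.derivative v)), ?_⟩
  rw [map_div₀, laurentDerivation_div]
  simp only [map_mul, map_sub, map_pow, map_inv₀]
  rw [← hu, ← hv]

open IntermediateField in
/-- The field generated by an algebraic series `ζ` is closed under differentiation: differentiate
the minimal polynomial equation of `ζ` to see that it contains `ζ'`. -/
theorem laurentDerivation_mem_adjoin {ζ : ℂ⸨X⸩} (hζ : IsAlgebraic (RatFunc ℂ) ζ) {x : ℂ⸨X⸩}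
    (hx : x ∈ (RatFunc ℂ)⟮ζ⟯) : laurentDerivation x ∈ (RatFunc ℂ)⟮ζ⟯ := by
  set K := (RatFunc ℂ)⟮ζ⟯ with hK
  have hζK : ζ ∈ K := mem_adjoin_simple_self _ ζ
  have haeval : ∀ P : (RatFunc ℂ)[X], Polynomial.aeval ζ P ∈ K := fun P =>
    (IntermediateField.aeval_coe K (⟨ζ, hζK⟩ : K) P) ▸ SetLike.coe_mem _
  have hder : ∀ P : (RatFunc ℂ)[X], ∃ e ∈ K, laurentDerivation (Polynomial.aeval ζ P) =
      e + Polynomial.aeval ζ (Polynomial.derivative P) * laurentDerivation ζ := by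
    intro P
    induction P using Polynomial.induction_on' with
    | add P Q hP hQ =>
      obtain ⟨e, he, h⟩ := hP
      obtain ⟨e', he', h'⟩ := hQ
      refine ⟨e + e', add_mem he he', ?_⟩
      rw [map_add, map_add, h, h', map_add, map_add]
      ring
    | monomial n c =>
      obtain ⟨c', hc'⟩ := laurentDerivation_algebraMap c
      refine ⟨algebraMap (RatFunc ℂ) ℂ⸨X⸩ c' * ζ ^ n,
        mul_mem (K.algebraMap_mem c') (pow_mem hζK n), ?_⟩
      rw [Polynomial.aeval_monomial, laurentDerivation_mul, laurentDerivation_pow, hc',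
        Polynomial.derivative_monomial, Polynomial.aeval_monomial, map_mul, map_natCast]
      ring
  have hζ' : laurentDerivation ζ ∈ K := by
    have hint : IsIntegral (RatFunc ℂ) ζ := hζ.isIntegral
    obtain ⟨e, he, h⟩ := hder (minpoly (RatFunc ℂ) ζ)
    rw [minpoly.aeval, map_zero] at h
    have hne : Polynomial.aeval ζ (Polynomial.derivative (minpoly (RatFunc ℂ) ζ)) ≠ 0 :=
      (minpoly.irreducible hint).separable.aeval_derivative_ne_zero (minpoly.aeval _ _)
    have : laurentDerivation ζ =
        -e / Polynomial.aeval ζ (Polynomial.derivative (minpoly (RatFunc ℂ) ζ)) := by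
      rw [eq_div_iff hne]
      linear_combination -h
    rw [this]
    exact div_mem (neg_mem he) (haeval _)
  obtain ⟨P, Q, rfl⟩ := (mem_adjoin_simple_iff (RatFunc ℂ) x).mp hx
  have hP : ∀ P : (RatFunc ℂ)[X], laurentDerivation (Polynomial.aeval ζ P) ∈ K := by
    intro P
    obtain ⟨e, he, h⟩ := hder P
    rw [h]
    exact add_mem he (mul_mem (haeval _) hζ')
  rw [laurentDerivation_div]
  exact mul_mem (pow_mem (inv_mem (haeval Q)) 2)
    (sub_mem (mul_mem (haeval Q) (hP P)) (mul_mem (haeval P) (hP Q)))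

open IntermediateField in
theorem isDFinite_of_mem_adjoin {ζ : ℂ⸨X⸩} (hζ : IsAlgebraic (RatFunc ℂ) ζ) {x : ℂ⸨X⸩}
    (hx : x ∈ (RatFunc ℂ)⟮ζ⟯) : IsDFinite x := by
  set K := (RatFunc ℂ)⟮ζ⟯ with hK
  have hfin : FiniteDimensional (RatFunc ℂ) K := adjoin.finiteDimensional hζ.isIntegral
  have hle : Submodule.span (RatFunc ℂ)
      (Set.range fun n : ℕ => (LaurentSeries.derivative ℂ)^[n] x) ≤
      Subalgebra.toSubmodule K.toSubalgebra := by
    rw [Submodule.span_le]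
    rintro _ ⟨n, rfl⟩
    change (LaurentSeries.derivative ℂ)^[n] x ∈ K
    induction n with
    | zero => exact hx
    | succ n ih =>
      rw [Function.iterate_succ_apply']
      exact laurentDerivation_mem_adjoin hζ ih
  have : FiniteDimensional (RatFunc ℂ) (Subalgebra.toSubmodule K.toSubalgebra) := hfin
  exact Submodule.finiteDimensional_of_le hle

open IntermediateField in
/-- The series `X ζ' / ζ` of an algebraic series `ζ` is D-finite. -/
theorem HasLogDeriv.isDFinite {ζ G : PowerSeries ℂ} (h : HasLogDeriv ζ G)
    (hζ : IsAlgebraic (RatFunc ℂ) (ζ : ℂ⸨X⸩)) : IsDFinite (G : ℂ⸨X⸩) := by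
  refine isDFinite_of_mem_adjoin hζ ?_
  have hζ0 : (ζ : ℂ⸨X⸩) ≠ 0 := by
    intro h0
    have h1 : ζ = 0 := HahnSeries.ofPowerSeries_injective (h0.trans (map_zero _).symm)
    have h2 := h.constantCoeff
    rw [h1, map_zero] at h2
    exact zero_ne_one h2
  have hG : (G : ℂ⸨X⸩) = algebraMap (RatFunc ℂ) ℂ⸨X⸩ RatFunc.X * laurentDerivation (ζ : ℂ⸨X⸩) /
      (ζ : ℂ⸨X⸩) := by
    rw [eq_div_iff hζ0, laurentDerivation_coe, RatFunc.coe_X, ← PowerSeries.coe_X, ← map_mul,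
      ← map_mul, ← h.deriv]
  have hmem := mem_adjoin_simple_self (RatFunc ℂ) (ζ : ℂ⸨X⸩)
  rw [hG]
  exact div_mem (mul_mem (IntermediateField.algebraMap_mem _ _)
    (laurentDerivation_mem_adjoin hζ hmem)) hmem

end AlgebraicDFinite

/-! ### The two cases of the zeta function -/

section Dichotomy

/-- If `N_k = r ^ k * ∏ [m_i ∤ k]`, the zeta function is algebraic and given by an
explicit product. -/
theorem artinMazurZeta_algebraic {Y : Type*} [TopologicalSpace Y] (f : Y → Y) (r : ℝ) {M : ℕ}
    (m : Fin M → ℕ) (hm : ∀ i, m i ≠ 0)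
    (h : ∀ k, k ≠ 0 → (numIsolated f k : ℝ) = r ^ k * ∏ i, if m i ∣ k then 0 else 1) :
    IsAlgebraic (RatFunc ℂ) (artinMazurZeta f : ℂ⸨X⸩) ∧
      artinMazurZeta f = (1 - PowerSeries.C (r : ℂ) * PowerSeries.X)⁻¹ *
        ∏ l ∈ Finset.Icc 1 M, ∏ S ∈ Finset.powersetCard l (Finset.univ : Finset (Fin M)),
          oneSubPow r (S.lcm m) ((-1) ^ (l + 1) / ((S.lcm m : ℕ) : ℚ)) := by
  have hprod := artinMazurZeta_eq_prod f r m hm h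
  refine ⟨?_, ?_⟩
  · rw [hprod, map_prod]
    refine Finset.prod_induction _ (IsAlgebraic (RatFunc ℂ)) (fun _ _ => IsAlgebraic.mul)
      isAlgebraic_one fun S _ => isAlgebraic_oneSubPow r (fun h0 => ?_) _
    obtain ⟨i, -, hi⟩ := Finset.lcm_eq_zero_iff.mp h0
    exact hm i hi
  · rw [hprod, prod_eq_mul_prod_powersetCard, inv_one_sub_eq_oneSubPow]
    congr 1
    · simp
    · refine Finset.prod_congr rfl fun l _ => Finset.prod_congr rfl fun S hS => ?_
      rw [(Finset.mem_powersetCard.mp hS).2]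

/-- If `N_k = r ^ k * ∏ [m_i ∤ k] * ∏_{n_j ∣ k} b_j ^ (p ^ v_p(k))` with `0 < b_j < 1`, and some
`n_j` is divisible by no `m_i`, the series `∑ N_k z ^ k` is not D-finite. -/
theorem not_isDFinite_fixedPointSeries {Y : Type*} [TopologicalSpace Y] (f : Y → Y) {p : ℕ}
    [Fact p.Prime] {r : ℝ} (hr : r ≠ 0) {M N : ℕ} {m : Fin M → ℕ} {n : Fin N → ℕ}
    (hm : ∀ i, ¬ p ∣ m i) (hn : ∀ j, ¬ p ∣ n j) {b : Fin N → ℝ} (hb0 : ∀ j, 0 < b j)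
    (hb1 : ∀ j, b j < 1)
    (h : ∀ k, k ≠ 0 → (numIsolated f k : ℝ) = r ^ k * ((∏ i, if m i ∣ k then 0 else 1) *
      ∏ j, if n j ∣ k then b j ^ p ^ padicValNat p k else 1))
    (hdvd : ∃ j, ∀ i, ¬ m i ∣ n j) : ¬ IsDFinite (fixedPointSeries f : ℂ⸨X⸩) := by
  have hp : p.Prime := Fact.out
  obtain ⟨j₀, hj₀⟩ := hdvd
  let c : ℤ → ℝ := fun x => (∏ i, if (m i : ℤ) ∣ x then 0 else 1) *
    ∏ j, if (n j : ℤ) ∣ x then b j else 1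
  let L : ℕ := (∏ i, m i) * ∏ j, n j
  have hpL : ¬ p ∣ L := by
    intro hd
    rcases hp.dvd_mul.mp hd with hd | hd
    · obtain ⟨i, -, hi⟩ := (hp.prime.dvd_finsetProd_iff _).mp hd
      exact hm i hi
    · obtain ⟨j, -, hj⟩ := (hp.prime.dvd_finsetProd_iff _).mp hd
      exact hn j hj
  have hL : L ≠ 0 := fun h0 => hpL (h0 ▸ dvd_zero p)
  have hmL : ∀ i, m i ∣ L := fun i =>
    (Finset.dvd_prod_of_mem m (Finset.mem_univ i)).mul_right _
  have hnL : ∀ j, n j ∣ L := fun j =>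
    (Finset.dvd_prod_of_mem n (Finset.mem_univ j)).mul_left _
  have hfac : ∀ j, 0 < (if (n j : ℤ) ∣ (n j₀ : ℤ) then b j else 1) ∧
      (if (n j : ℤ) ∣ (n j₀ : ℤ) then b j else 1) ≤ 1 := by
    intro j
    split_ifs
    · exact ⟨hb0 j, (hb1 j).le⟩
    · exact ⟨one_pos, le_rfl⟩
  have hca : c (n j₀) = ∏ j, if (n j : ℤ) ∣ (n j₀ : ℤ) then b j else 1 := by
    have h1 : (∏ i, if (m i : ℤ) ∣ (n j₀ : ℤ) then (0 : ℝ) else 1) = 1 :=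
      Finset.prod_eq_one fun i _ => if_neg (by exact_mod_cast hj₀ i)
    simp only [c, h1, one_mul]
  have hca0 : 0 < c (n j₀) := hca ▸ Finset.prod_pos fun j _ => (hfac j).1
  have hca1 : c (n j₀) < 1 := by
    rw [hca, ← Finset.mul_prod_erase _ _ (Finset.mem_univ j₀), if_pos dvd_rfl]
    refine (mul_le_of_le_one_right (hb0 j₀).le ?_).trans_lt (hb1 j₀)
    exact Finset.prod_le_one (fun j _ => (hfac j).1.le) fun j _ => (hfac j).2
  refine not_isDFinite_of_coeff_eq (p := p) (n := L) (r := (r : ℂ)) (c := fun x => (c x : ℂ))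
    (a := n j₀) hL hpL (by exact_mod_cast hr) ?_ (by exact_mod_cast hca0.ne') ?_ ?_
  · intro x y hxy
    have h1 : ∀ i, (m i : ℤ) ∣ x ↔ (m i : ℤ) ∣ y := fun i =>
      dvd_iff_dvd_of_dvd_sub ((Int.natCast_dvd_natCast.mpr (hmL i)).trans hxy)
    have h2 : ∀ j, (n j : ℤ) ∣ x ↔ (n j : ℤ) ∣ y := fun j =>
      dvd_iff_dvd_of_dvd_sub ((Int.natCast_dvd_natCast.mpr (hnL j)).trans hxy)
    simp only [c, h1, h2]
  · rwa [Complex.norm_real, Real.norm_of_nonneg hca0.le]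
  · intro x hx
    obtain ⟨k, rfl⟩ := Int.eq_ofNat_of_zero_le hx.le
    have hk : k ≠ 0 := by omega
    have hpow : p ^ padicValNat p k ≠ 0 := pow_ne_zero _ hp.ne_zero
    rw [PowerSeries.coeff_coe, if_neg (by omega), Int.natAbs_natCast, fixedPointSeries,
      PowerSeries.coeff_mk, if_neg hk, padicValInt.of_nat, zpow_natCast]
    have h1 : (numIsolated f k : ℝ) = r ^ k * c k ^ p ^ padicValNat p k := by
      rw [h k hk]
      simp only [c, Int.natCast_dvd_natCast, mul_pow, ← Finset.prod_pow, ite_pow, one_pow,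
        zero_pow hpow]
    exact_mod_cast congrArg Complex.ofReal h1

theorem summable_numIsolated {Y : Type*} [TopologicalSpace Y] (f : Y → Y) {r : ℝ} (hr : 0 < r)
    (h : ∀ k, k ≠ 0 → (numIsolated f k : ℝ) ≤ r ^ k) {z : ℂ} (hz : ‖z‖ < 1 / r) :
    Summable fun k : ℕ => (numIsolated f (k + 1) : ℂ) * z ^ (k + 1) := by
  have hrz : r * ‖z‖ < 1 := by rwa [lt_div_iff₀ hr, mul_comm] at hz
  refine Summable.of_norm_bounded (g := fun k : ℕ => (r * ‖z‖) ^ (k + 1)) ?_ fun k => ?_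
  · exact (summable_nat_add_iff 1).mpr
      (summable_geometric_of_lt_one (mul_nonneg hr.le (norm_nonneg z)) hrz)
  · rw [norm_mul, norm_pow, Complex.norm_natCast, mul_pow]
    exact mul_le_mul_of_nonneg_right (h _ k.succ_ne_zero) (pow_nonneg (norm_nonneg z) _)

end Dichotomy

open scoped Classical in
theorem theorem1p4 {F : Type*} [Field F] [Finite F] {d : ℕ} (hd : 0 < d)
    (A : Matrix (Fin d) (Fin d) F[X]) {M N : ℕ} (μ : Fin M → RFbar F) (η : Fin N → RFbar F)
    (hμ : Finset.univ.val.map μ = (eigenvaluesBar A).filter fun l => IsOfFinOrder l)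
    (hη : Finset.univ.val.map η =
      (eigenvaluesBar A).filter fun l => absBar l = 1 ∧ ¬ IsOfFinOrder l) :
    (∀ k : ℕ, 1 ≤ k →
      (isolatedFixedPoints (torusEnd A)^[k]).Finite ∧
        (numIsolated (torusEnd A) k : ℝ) = ‖polyToRF F (A ^ k - 1).det‖) ∧
    ((∀ j, ∃ i, orderMod (μ i) ∣ orderMod (η j)) →
      IsAlgebraic (RatFunc ℂ) (artinMazurZeta (torusEnd A) : ℂ⸨X⸩) ∧
        artinMazurZeta (torusEnd A) =
          (1 - PowerSeries.C (rOf A : ℂ) * PowerSeries.X)⁻¹ *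
            ∏ l ∈ Finset.Icc 1 M, ∏ S ∈ Finset.powersetCard l (Finset.univ : Finset (Fin M)),
              oneSubPow (rOf A) (S.lcm fun i => orderMod (μ i))
                ((-1) ^ (l + 1) / ((S.lcm fun i => orderMod (μ i) : ℕ) : ℚ))) ∧
    ((∃ j, ∀ i, ¬ orderMod (μ i) ∣ orderMod (η j)) →
      (∀ z : ℂ, ‖z‖ < 1 / rOf A →
        Summable fun k : ℕ => (numIsolated (torusEnd A) (k + 1) : ℂ) * z ^ (k + 1)) ∧
      ¬ IsDFinite (fixedPointSeries (torusEnd A) : ℂ⸨X⸩) ∧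
      Transcendental (RatFunc ℂ) (artinMazurZeta (torusEnd A) : ℂ⸨X⸩)) := by
  obtain ⟨p, hchar⟩ := CharP.exists F
  have : Fact p.Prime := ⟨CharP.char_is_prime F p⟩
  have hη1 : ∀ j, absBar (η j) = 1 ∧ ¬ IsOfFinOrder (η j) := fun j => by
    have : η j ∈ Finset.univ.val.map η := Multiset.mem_map_of_mem η (Finset.mem_univ j)
    rw [hη] at this
    exact (Multiset.mem_filter.mp this).2
  have hμ1 : ∀ i, absBar (μ i) = 1 := fun i => by
    have : μ i ∈ Finset.univ.val.map μ := Multiset.mem_map_of_mem μ (Finset.mem_univ i)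
    rw [hμ] at this
    exact absBar_eq_one_of_isOfFinOrder (Multiset.mem_filter.mp this).2
  have hb0 : ∀ j, 0 < absBar (η j ^ orderMod (η j) - 1) := fun j => by
    refine absBar_pos fun h0 => (hη1 j).2 ?_
    exact isOfFinOrder_iff_pow_eq_one.mpr ⟨_, orderMod_pos (hη1 j).1, sub_eq_zero.mp h0⟩
  have hb1 : ∀ j, absBar (η j ^ orderMod (η j) - 1) < 1 := fun j =>
    absBar_pow_sub_one_lt (hη1 j).1 dvd_rfl
  have hr : 0 < rOf A := one_pos.trans_le (one_le_rOf A)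
  have hN : ∀ k, k ≠ 0 → (numIsolated (torusEnd A) k : ℝ) =
      rOf A ^ k * ((∏ i, if orderMod (μ i) ∣ k then 0 else 1) *
        ∏ j, if orderMod (η j) ∣ k then
          absBar (η j ^ orderMod (η j) - 1) ^ p ^ padicValNat p k else 1) := fun k hk => by
    rw [(numIsolated_torusEnd A k).2, norm_det_pow_sub_one p A hμ hη hk]
  refine ⟨fun k _ => numIsolated_torusEnd A k, fun hdvd => ?_, fun hdvd => ?_⟩
  · refine artinMazurZeta_algebraic (torusEnd A) (rOf A) (fun i => orderMod (μ i))
      (fun i => (orderMod_pos (hμ1 i)).ne') fun k hk => ?_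
    rw [hN k hk]
    congr 1
    -- a factor for `η j` differs from `1` only if `k` is a multiple of the order of some `μ i`
    by_cases h : ∃ i, orderMod (μ i) ∣ k
    · obtain ⟨i, hi⟩ := h
      have hzero : (∏ i, if orderMod (μ i) ∣ k then (0 : ℝ) else 1) = 0 :=
        Finset.prod_eq_zero (Finset.mem_univ i) (if_pos hi)
      rw [hzero, zero_mul]
    · have hone : (∏ j, if orderMod (η j) ∣ k then
          absBar (η j ^ orderMod (η j) - 1) ^ p ^ padicValNat p k else 1) = 1 := by
        refine Finset.prod_eq_one fun j _ => if_neg fun hj => ?_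
        obtain ⟨i, hi⟩ := hdvd j
        exact h ⟨i, hi.trans hj⟩
      rw [hone, mul_one]
  · have hnot := not_isDFinite_fixedPointSeries (torusEnd A) (p := p) hr.ne'
      (fun i => not_dvd_orderMod p (hμ1 i)) (fun j => not_dvd_orderMod p (hη1 j).1) hb0 hb1 hN hdvd
    refine ⟨fun z hz => summable_numIsolated (torusEnd A) hr (fun k hk => ?_) hz, hnot,
      fun halg => hnot ((hasLogDeriv_artinMazurZeta (torusEnd A)).isDFinite halg)⟩
    rw [hN k hk]
    refine mul_le_of_le_one_right (pow_nonneg hr.le k) (mul_le_one₀ ?_ ?_ ?_)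
    · exact Finset.prod_le_one (fun i _ => by split_ifs <;> norm_num)
        fun i _ => by split_ifs <;> norm_num
    · exact Finset.prod_nonneg fun j _ => by
        split_ifs
        · exact pow_nonneg (hb0 j).le _
        · exact zero_le_one
    · refine Finset.prod_le_one (fun j _ => ?_) fun j _ => ?_
      · split_ifs
        · exact pow_nonneg (hb0 j).le _
        · exact zero_le_one
      · split_ifs
        · exact pow_le_one₀ (hb0 j).le (hb1 j).le
        · exact le_rfl
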